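/- An instance $I$ of the \emph{two-sided model with one-sided ties} consists of a finite bipartite graph $G=(A\cup B,E)$ (agents $A$, jobs $B$) in which every agent $a\in A$ ranks her neighbours strictly, while every job $b\in B$ is indifferent between all its neighbours; being unmatched is the worst outcome for every vertex. For matchings $M,N$ of $G$, an agent prefers $M$ to $N$ if she is matched in $M$ and is in $N$ either unmatched or matched to a job that she ranks strictly lower; a job prefers $M$ to $N$ if it is matched in $M$ and unmatched in $N$. Let $\phi_I(M,N)$ be the number of vertices of $A\cup B$ that prefer $M$ to $N$. A matching $M$ is \emph{popular} in $I$ if $\phi_I(M,N)\ge\phi_I(N,M)$ for every matching $N$ of $G$. A matching is \emph{robust popular} with respect to two instances $(I,I')$ if it is popular in both. \textbf{Theorem.} There is a polynomial-time algorithm (a single random access machine program, operating on natural numbers with unit-cost addition and subtraction but no multiplication, whose running time is at most $p(|A|+|B|+|E|)$ for a fixed polynomial $p$) which, given a pair $(I,I')$ of instances of the two-sided model with one-sided ties that have the same underlying graph $G=(A\cup B,E)$ and differ only in the preference order of a single agent $a\in A$, decides whether a robust popular matching with respect to $I$ and $I'$ exists, and outputs one if it does. -/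

import Mathlib

/-!
## The two-sided model with one-sided ties
-/

namespace PopularMatching

/-- An instance of the two-sided model with one-sided ties, with agents `A = Fin m` and jobs
`B = Fin n`. Every agent has a preference list, which enumerates her neighbours without repetition
in strictly decreasing order of preference; the edges of the bipartite graph are the pairs `(a, b)`
with `b` on the list of `a`. A job puts all its neighbours into one tie, so it carries no data. -/
structure Market (m n : ℕ) where
  list : Fin m → List (Fin n)
  nodup : ∀ a, (list a).Nodup

variable {m n : ℕ}

namespace Market

/-- The edge relation of the underlying bipartite graph. -/
def Edge (I : Market m n) (a : Fin m) (b : Fin n) : Prop := b ∈ I.list a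

/-- Agent `a` strictly prefers her neighbour `b` to her neighbour `c`. -/
def Above (I : Market m n) (a : Fin m) (b c : Fin n) : Prop :=
  I.Edge a b ∧ I.Edge a c ∧ (I.list a).idxOf b < (I.list a).idxOf c

/-- The number of vertices plus the number of edges. -/
def size (I : Market m n) : ℕ := m + n + ∑ a, (I.list a).length

/-- `M` is a matching: a set of pairwise disjoint edges. -/
def IsMatching (I : Market m n) (M : Finset (Fin m × Fin n)) : Prop :=
  (∀ e ∈ M, I.Edge e.1 e.2) ∧ ∀ e ∈ M, ∀ f ∈ M, e ≠ f → e.1 ≠ f.1 ∧ e.2 ≠ f.2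

/-- Agent `a` prefers the matching `M` to the matching `N`: she is matched in `M`, and in `N` she is
either unmatched or matched to a less preferred job. -/
def AgentPrefers (I : Market m n) (M N : Finset (Fin m × Fin n)) (a : Fin m) : Prop :=
  ∃ b, (a, b) ∈ M ∧ ∀ c, (a, c) ∈ N → I.Above a b c

/-- Job `b` prefers the matching `M` to the matching `N`: it is matched in `M` and not in `N`. -/
def JobPrefers (M N : Finset (Fin m × Fin n)) (b : Fin n) : Prop :=
  (∃ a, (a, b) ∈ M) ∧ ¬ ∃ a, (a, b) ∈ N

instance (I : Market m n) (a : Fin m) (b : Fin n) : Decidable (I.Edge a b) := by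
  unfold Edge; infer_instance

instance (I : Market m n) (a : Fin m) (b c : Fin n) : Decidable (I.Above a b c) := by
  unfold Above; infer_instance

instance (I : Market m n) (M N : Finset (Fin m × Fin n)) : DecidablePred (I.AgentPrefers M N) :=
  fun a => by unfold AgentPrefers; infer_instance

instance (M N : Finset (Fin m × Fin n)) : DecidablePred (JobPrefers M N) :=
  fun b => by unfold JobPrefers; infer_instance

/-- `φ(M, N)`, the number of vertices (agents and jobs) that prefer `M` to `N`. -/
def votes (I : Market m n) (M N : Finset (Fin m × Fin n)) : ℕ :=
  (Finset.univ.filter (I.AgentPrefers M N)).card + (Finset.univ.filter (JobPrefers M N)).card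

/-- `M` is a popular matching: no matching beats it in a majority vote. -/
def IsPopular (I : Market m n) (M : Finset (Fin m × Fin n)) : Prop :=
  I.IsMatching M ∧ ∀ N, I.IsMatching N → I.votes N M ≤ I.votes M N

/-- `M` is a robust popular matching for the pair `(I, J)`: it is popular in both instances. -/
def IsRobustPopular (I J : Market m n) (M : Finset (Fin m × Fin n)) : Prop :=
  I.IsPopular M ∧ J.IsPopular M

/-- `I` and `J` have the same underlying graph and differ only in the preference order of a single
agent. -/
def DifferInOneAgent (I J : Market m n) : Prop :=
  (∀ a b, I.Edge a b ↔ J.Edge a b) ∧ ∃ a, ∀ x, x ≠ a → I.list x = J.list x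

/-- The preference lists of all agents, each preceded by its length, as one word. -/
def code (I : Market m n) : List ℕ :=
  (List.finRange m).flatMap fun a => (I.list a).length :: (I.list a).map Fin.val

end Market

/-- The input word of the algorithm: the number of agents, the number of jobs, the preference lists
of the first instance and those of the second. -/
def inputWord (I J : Market m n) : List ℕ := m :: n :: (I.code ++ J.code)

/-!
## Random access machines

Programs over finitely many arrays of natural numbers with indirect addressing, addition and
truncated subtraction (no multiplication), at unit cost for each operation.
-/

/-- The memory: `s r i` is the content of cell `i` of array `r`. -/
abbrev Store := ℕ → ℕ → ℕ

/-- Arithmetic expressions. -/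
inductive Expr where
  | const (k : ℕ)
  | read (r : ℕ) (i : Expr)
  | plus (e f : Expr)
  | minus (e f : Expr)

namespace Expr

/-- The value of an expression. -/
def eval (s : Store) : Expr → ℕ
  | const k => k
  | read r i => s r (i.eval s)
  | plus e f => e.eval s + f.eval s
  | minus e f => e.eval s - f.eval s

/-- The number of elementary operations needed to evaluate an expression. -/
def cost : Expr → ℕ
  | const _ => 1
  | read _ i => i.cost + 1
  | plus e f => e.cost + f.cost + 1
  | minus e f => e.cost + f.cost + 1

end Expr

/-- Programs. A condition `e` counts as true when its value is not zero. -/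
inductive Prog where
  | skip
  | write (r : ℕ) (i e : Expr)
  | seq (c d : Prog)
  | cond (e : Expr) (c d : Prog)
  | loop (e : Expr) (c : Prog)

/-- The memory after writing `v` into cell `i` of array `r`. -/
def Store.set (s : Store) (r i v : ℕ) : Store :=
  Function.update s r (Function.update (s r) i v)

/-- `Exec c s s' t`: the program `c`, started with memory `s`, halts after exactly `t` steps with
memory `s'`. -/
inductive Exec : Prog → Store → Store → ℕ → Prop where
  | skip (s : Store) : Exec .skip s s 1
  | write (r : ℕ) (i e : Expr) (s : Store) :
      Exec (.write r i e) s (s.set r (i.eval s) (e.eval s)) (i.cost + e.cost + 1)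
  | seq {c d : Prog} {s₁ s₂ s₃ : Store} {t₁ t₂ : ℕ} :
      Exec c s₁ s₂ t₁ → Exec d s₂ s₃ t₂ → Exec (.seq c d) s₁ s₃ (t₁ + t₂)
  | cond_true {e : Expr} {c d : Prog} {s s₁ : Store} {t : ℕ} :
      e.eval s ≠ 0 → Exec c s s₁ t → Exec (.cond e c d) s s₁ (e.cost + 1 + t)
  | cond_false {e : Expr} {c d : Prog} {s s₁ : Store} {t : ℕ} :
      e.eval s = 0 → Exec d s s₁ t → Exec (.cond e c d) s s₁ (e.cost + 1 + t)
  | loop_true {e : Expr} {c : Prog} {s s₁ s₂ : Store} {t₁ t₂ : ℕ} :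
      e.eval s ≠ 0 → Exec c s s₁ t₁ → Exec (.loop e c) s₁ s₂ t₂ →
      Exec (.loop e c) s s₂ (e.cost + 1 + t₁ + t₂)
  | loop_false {e : Expr} {c : Prog} {s : Store} :
      e.eval s = 0 → Exec (.loop e c) s s (e.cost + 1)

/-- The initial memory on input `w`: the word `w` stands in array `0`, all other cells are zero. -/
def inputStore (w : List ℕ) : Store := fun r i => if r = 0 then w.getD i 0 else 0

/-- The verdict, in cell `0` of array `1` of the final memory. -/
def verdict (s : Store) : ℕ := s 1 0

/-- The set of edges `(a, b)` written in array `1` of the final memory: cell `a + 1` holds `b + 1`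
if `a` is matched to `b`, and holds `0` (or any other number) if `a` is unmatched. -/
def outputEdges (m n : ℕ) (s : Store) : Finset (Fin m × Fin n) :=
  Finset.univ.filter fun e => s 1 (e.1.val + 1) = e.2.val + 1

end PopularMatching

/-!
A matching is popular if and only if it is an optimal assignment for the weights that count the
votes, so by linear programming duality its popularity is certified by potentials. As jobs are
indifferent between their neighbours, the potentials amount to levels in `{0, 1, 2}` of the jobs:
unmatched jobs have level `0`, the neighbours of an unmatched agent have level `2`, and for a
matched agent every job that she prefers to her partner has a greater level than the partner, while
her other neighbours are at most one level below it. Only one agent has different preferences in the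
two instances. If she votes with the union of her two strict preferences, her vote between two given
matchings agrees with her vote in one of the instances, so a single system of levels certifies
popularity in both.

To find a matching with such levels, start with the greatest levels and auction off the jobs of
positive level at ascending prices, where an agent may bid for the jobs that the levels allow her.
If a job is unsold when the bidding stops, its level is too high for every solution; lower it and
start anew. Once all jobs of positive level are sold, offer everything else as well, including for
each agent the option to stay unmatched. Either all agents are served, which gives a solution, or
some agent is priced out, which proves that there is none.
-/

namespace PopularMatching

section Potential

variable {V G : Type*} [AddCommGroup G]

/-- The total weight of the arcs that a walk traverses; the walk is the list of its vertices. -/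
def walkWeight (w : V → V → G) : List V → G
  | u :: v :: l => w u v + walkWeight w (v :: l)
  | _ => 0

theorem walkWeight_append_cons (w : V → V → G) (l₁ : List V) (u : V) (l₂ : List V) :
    walkWeight w (l₁ ++ u :: l₂) = walkWeight w (l₁ ++ [u]) + walkWeight w (u :: l₂) := by
  induction l₁ with
  | nil => simp [walkWeight]
  | cons x l ih =>
    cases l with
    | nil => simp [walkWeight]
    | cons y l =>
      simp only [List.cons_append, walkWeight] at ih ⊢
      rw [ih, add_assoc]

theorem sum_map_eq_walkWeight (w : V → V → G) {f : V → V} {l : List V} {u : V}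
    (h : (l ++ [u]).IsChain fun x y => f x = y) :
    (l.map fun x => w x (f x)).sum = walkWeight w (l ++ [u]) := by
  induction l with
  | nil => rfl
  | cons x l ih =>
    cases l with
    | nil =>
      obtain rfl : f x = u := by simpa using h
      simp [walkWeight]
    | cons y l =>
      obtain ⟨rfl, h⟩ := List.isChain_cons_cons.1 h
      simpa [walkWeight] using ih h

theorem exists_potential_of_cycle_nonpos [Finite V] [LinearOrder G] [IsOrderedAddMonoid G]
    {r : V → V → Prop} {w : V → V → G}
    (h : ∀ v l, l ≠ [] → (v :: l).Nodup → (v :: l ++ [v]).IsChain r →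
      walkWeight w (v :: l ++ [v]) ≤ 0) :
    ∃ p : V → G, ∀ u v, r u v → u ≠ v → p u + w u v ≤ p v := by
  let paths : V → Set (List V) := fun v => {l | ∃ l', l = v :: l' ∧ l.Nodup ∧ l.IsChain r}
  have paths_finite : ∀ v, (paths v).Finite := fun v =>
    (@Set.toFinite _ {l : List V | l.Nodup} (by
      have := Fintype.ofFinite V
      classical exact inferInstanceAs (Finite {l : List V // l.Nodup}))).subset
      fun l ⟨_, _, hl, _⟩ => hl
  have exists_heaviest : ∀ v, ∃ l ∈ paths v, ∀ l' ∈ paths v, walkWeight w l' ≤ walkWeight w l :=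
    fun v => Set.exists_max_image (paths v) (walkWeight w) (paths_finite v)
      ⟨[v], [], rfl, by simp, by simp⟩
  choose best hbest hmax using exists_heaviest
  refine ⟨fun v => -walkWeight w (best v), fun u v huv hne => ?_⟩
  suffices w u v + walkWeight w (best v) ≤ walkWeight w (best u) by grind
  obtain ⟨l, hl, hnodup, hchain⟩ := hbest v
  rw [hl] at hnodup hchain ⊢
  by_cases hu : u ∈ v :: l
  · obtain ⟨l₁, l₂, rfl⟩ := List.append_of_mem (List.mem_of_ne_of_mem hne hu)
    have hchain' : (v :: l₁ ++ [u]).IsChain r :=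
      List.IsChain.left_of_append (l₂ := l₂) (by simpa using hchain)
    have hcycle : walkWeight w (u :: (v :: l₁) ++ [u]) ≤ 0 := by
      have hnodup' : (v :: l₁ ++ [u]).Nodup := hnodup.sublist (by simp)
      exact h u (v :: l₁) (by simp) ((List.perm_append_singleton u (v :: l₁)).nodup_iff.1 hnodup')
        (List.isChain_cons_cons.2 ⟨huv, hchain'⟩)
    have htail : walkWeight w (u :: l₂) ≤ walkWeight w (best u) :=
      hmax u _ ⟨l₂, rfl, hnodup.sublist (by simp), hchain.suffix ⟨v :: l₁, by simp⟩⟩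
    calc w u v + walkWeight w (v :: (l₁ ++ u :: l₂))
        = walkWeight w (u :: (v :: l₁) ++ [u]) + walkWeight w (u :: l₂) := by
          rw [← List.cons_append, walkWeight_append_cons, ← add_assoc]; rfl
      _ ≤ walkWeight w (best u) := by grind
  · exact hmax u _ ⟨v :: l, rfl, List.nodup_cons.2 ⟨hu, hnodup⟩,
      List.isChain_cons_cons.2 ⟨huv, hchain⟩⟩

theorem isChain_formPerm [DecidableEq V] {v : V} {l : List V} (hnodup : (v :: l).Nodup) :
    (v :: l ++ [v]).IsChain fun x y => (v :: l).formPerm x = y := by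
  rw [List.isChain_iff_getElem]
  intro i hi
  have hi' : i < (v :: l).length := by simpa using hi
  rw [List.getElem_append_left hi', List.formPerm_apply_getElem _ hnodup]
  rcases (Nat.succ_le_of_lt hi').lt_or_eq with hlt | heq
  · simp only [Nat.mod_eq_of_lt hlt, List.getElem_append_left hlt]
  · simp only [Nat.succ_eq_add_one] at heq
    simp [heq]

theorem sum_formPerm_eq_walkWeight [Fintype V] [DecidableEq V] {w : V → V → G}
    (hw : ∀ v, w v v = 0) {v : V} {l : List V} (hnodup : (v :: l).Nodup) :
    ∑ x, w x ((v :: l).formPerm x) = walkWeight w (v :: l ++ [v]) := by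
  rw [← sum_map_eq_walkWeight w (isChain_formPerm hnodup), ← List.sum_toFinset _ hnodup]
  refine (Finset.sum_subset (Finset.subset_univ _) fun x _ hx => ?_).symm
  rw [List.formPerm_apply_of_notMem (by simpa using hx), hw]

theorem exists_potential_of_perm_nonpos [Fintype V] [LinearOrder G] [IsOrderedAddMonoid G]
    {r : V → V → Prop} {w : V → V → G} (hw : ∀ v, w v v = 0)
    (h : ∀ σ : Equiv.Perm V, (∀ v, σ v = v ∨ r v (σ v)) → ∑ v, w v (σ v) ≤ 0) :
    ∃ p : V → G, ∀ u v, r u v → p u + w u v ≤ p v := by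
  classical
  obtain ⟨p, hp⟩ := exists_potential_of_cycle_nonpos (r := r) (w := w)
    fun v l _ hnodup hchain => by
      rw [← sum_formPerm_eq_walkWeight hw hnodup]
      refine h _ fun x => ?_
      by_cases hx : x ∈ v :: l
      · obtain ⟨i, hi, rfl⟩ := List.getElem_of_mem hx
        have hi' : i + 1 < (v :: l ++ [v]).length := by simpa using hi
        have hstep := List.isChain_iff_getElem.1 (isChain_formPerm hnodup) i hi'
        have harc := List.isChain_iff_getElem.1 hchain i hi'
        rw [List.getElem_append_left hi] at hstep harc
        exact Or.inr (hstep ▸ harc)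
      · exact Or.inl (List.formPerm_apply_of_notMem hx)
  refine ⟨p, fun u v huv => ?_⟩
  rcases eq_or_ne u v with rfl | hne
  · rw [hw, add_zero]
  · exact hp u v huv hne

end Potential

section Popularity

variable {m n : ℕ}

/-- The edge set of a partial assignment of jobs to agents. -/
def edgesOf (f : Fin m → Option (Fin n)) : Finset (Fin m × Fin n) :=
  Finset.univ.filter fun e => f e.1 = some e.2

@[simp]
theorem mem_edgesOf {f : Fin m → Option (Fin n)} {a : Fin m} {b : Fin n} :
    (a, b) ∈ edgesOf f ↔ f a = some b := by
  simp [edgesOf]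

namespace Market

/-- A matching, presented as the partial function that sends an agent to her job. -/
structure IsAssignment (I : Market m n) (f : Fin m → Option (Fin n)) : Prop where
  edge : ∀ {a b}, f a = some b → I.Edge a b
  inj : ∀ {a a' b}, f a = some b → f a' = some b → a = a'

theorem isMatching_edgesOf {I : Market m n} {f : Fin m → Option (Fin n)} :
    I.IsMatching (edgesOf f) ↔ I.IsAssignment f := by
  constructor
  · rintro ⟨hedge, hdisj⟩
    refine ⟨fun h => hedge _ (mem_edgesOf.2 h), fun h h' => ?_⟩
    by_contra hne
    exact (hdisj _ (mem_edgesOf.2 h) _ (mem_edgesOf.2 h') fun he =>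
      hne (congrArg Prod.fst he)).2 rfl
  · intro hf
    refine ⟨fun e he => hf.edge (mem_edgesOf.1 he), ?_⟩
    rintro ⟨a, b⟩ he ⟨a', b'⟩ he' hne
    rw [mem_edgesOf] at he he'
    constructor
    · rintro rfl
      exact hne (by rw [Option.some.inj (he.symm.trans he')])
    · rintro rfl
      exact hne (by rw [hf.inj he he'])

theorem IsMatching.exists_eq_edgesOf {I : Market m n} {M : Finset (Fin m × Fin n)}
    (hM : I.IsMatching M) : ∃ f, M = edgesOf f := by
  classical
  refine ⟨fun a => if h : ∃ b, (a, b) ∈ M then some h.choose else none, ?_⟩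
  ext ⟨a, b⟩
  rw [mem_edgesOf]
  constructor
  · intro hab
    have hex : ∃ b, (a, b) ∈ M := ⟨b, hab⟩
    rw [dif_pos hex]
    by_contra hne
    exact (hM.2 _ hex.choose_spec _ hab fun he => hne (congrArg (some ·.2) he)).1 rfl
  · intro h
    split_ifs at h with hex
    exact Option.some.inj h ▸ hex.choose_spec

theorem Above.asymm {I : Market m n} {a : Fin m} {b c : Fin n} (h : I.Above a b c) :
    ¬ I.Above a c b :=
  fun h' => h.2.2.asymm h'.2.2

theorem Edge.above_or_above {I : Market m n} {a : Fin m} {b c : Fin n} (hb : I.Edge a b)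
    (hc : I.Edge a c) (hne : b ≠ c) : I.Above a b c ∨ I.Above a c b := by
  rcases lt_trichotomy ((I.list a).idxOf b) ((I.list a).idxOf c) with h | h | h
  · exact Or.inl ⟨hb, hc, h⟩
  · exact absurd ((List.idxOf_inj hb).1 h) hne
  · exact Or.inr ⟨hc, hb, h⟩

end Market

open Classical in
/-- The votes won, minus those lost, when an agent with preference relation `R` moves from the
partner `y` to the partner `x`. Jobs are indifferent between agents, so that their votes can be
charged to the agents: one vote for the job that is taken and minus one for the job that is left. -/
noncomputable def gain {β : Type*} (R : β → β → Prop) : (x y : Option β) → ℤ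
  | none, none => 0
  | some _, none => 2
  | none, some _ => -2
  | some b, some c => if b = c then 0 else if R b c then 1 else -1

@[simp]
theorem gain_self {β : Type*} (R : β → β → Prop) (x : Option β) : gain R x x = 0 := by
  cases x <;> simp [gain]

theorem gain_or {β : Type*} (R S : β → β → Prop) (x y : Option β) :
    gain (fun b c => R b c ∨ S b c) x y = gain R x y ∨
      gain (fun b c => R b c ∨ S b c) x y = gain S x y := by
  rcases x with _ | b <;> rcases y with _ | c <;> simp only [gain, or_self]
  by_cases hR : R b c <;> by_cases hS : S b c <;> simp [hR, hS]

open Classical in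
theorem Market.IsAssignment.sum_elim {I : Market m n} {f : Fin m → Option (Fin n)}
    (hf : I.IsAssignment f) (q : Fin n → ℤ) :
    ∑ a, (f a).elim 0 q = ∑ b, if ∃ a, f a = some b then q b else 0 := by
  have hpoint : ∀ a, (f a).elim 0 q = ∑ b, if f a = some b then q b else 0 := fun a => by
    cases f a <;> simp
  simp_rw [hpoint]
  rw [Finset.sum_comm]
  refine Finset.sum_congr rfl fun b _ => ?_
  split_ifs with h
  · obtain ⟨a, ha⟩ := h
    rw [Finset.sum_eq_single a, if_pos ha]
    · exact fun a' _ hne => if_neg fun ha' => hne (hf.inj ha' ha)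
    · simp
  · exact Finset.sum_eq_zero fun a _ => if_neg fun ha => h ⟨a, ha⟩

theorem Market.gain_above_eq {I : Market m n} {f g : Fin m → Option (Fin n)}
    (hf : I.IsAssignment f) (hg : I.IsAssignment g) (a : Fin m) :
    gain (I.Above a) (g a) (f a) =
      (if I.AgentPrefers (edgesOf g) (edgesOf f) a then 1 else 0) -
        (if I.AgentPrefers (edgesOf f) (edgesOf g) a then 1 else 0) +
      ((g a).elim 0 (fun _ => 1) - (f a).elim 0 (fun _ => 1)) := by
  simp only [Market.AgentPrefers, mem_edgesOf]
  rcases hga : g a with _ | b <;> rcases hfa : f a with _ | c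
  · simp [gain]
  · simp [gain]
  · simp [gain]
  · rcases eq_or_ne b c with rfl | hbc
    · simp [gain]
    · rcases (hg.edge hga).above_or_above (hf.edge hfa) hbc with h | h <;>
        simp [gain, hbc, h, h.asymm]

open Classical in
theorem jobPrefers_sub_jobPrefers (f g : Fin m → Option (Fin n)) (b : Fin n) :
    (if Market.JobPrefers (edgesOf g) (edgesOf f) b then 1 else 0) -
        (if Market.JobPrefers (edgesOf f) (edgesOf g) b then 1 else 0) =
      (if ∃ a, g a = some b then (1 : ℤ) else 0) - (if ∃ a, f a = some b then 1 else 0) := by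
  simp only [Market.JobPrefers, mem_edgesOf]
  by_cases hg : ∃ a, g a = some b <;> by_cases hf : ∃ a, f a = some b <;> simp [hg, hf]

theorem Market.votes_sub_votes {I : Market m n} {f g : Fin m → Option (Fin n)}
    (hf : I.IsAssignment f) (hg : I.IsAssignment g) :
    (I.votes (edgesOf g) (edgesOf f) : ℤ) - I.votes (edgesOf f) (edgesOf g) =
      ∑ a, gain (I.Above a) (g a) (f a) := by
  classical
  have hjobs := Finset.sum_congr rfl fun b (_ : b ∈ Finset.univ) => jobPrefers_sub_jobPrefers f g b
  simp_rw [Market.gain_above_eq hf hg, Finset.sum_add_distrib, Finset.sum_sub_distrib,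
    hg.sum_elim, hf.sum_elim]
  rw [Finset.sum_sub_distrib, Finset.sum_sub_distrib] at hjobs
  simp only [Market.votes, Finset.card_filter, Nat.cast_add, Nat.cast_sum, Nat.cast_ite,
    Nat.cast_one, Nat.cast_zero]
  linarith

theorem Market.isPopular_edgesOf {I : Market m n} {f : Fin m → Option (Fin n)} :
    I.IsPopular (edgesOf f) ↔
      I.IsAssignment f ∧ ∀ g, I.IsAssignment g → ∑ a, gain (I.Above a) (g a) (f a) ≤ 0 := by
  rw [Market.IsPopular, Market.isMatching_edgesOf]
  refine and_congr_right fun hf => ⟨fun h g hg => ?_, fun h N hN => ?_⟩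
  · rw [← Market.votes_sub_votes hf hg, sub_nonpos]
    exact_mod_cast h _ (Market.isMatching_edgesOf.2 hg)
  · obtain ⟨g, rfl⟩ := hN.exists_eq_edgesOf
    have hg := Market.isMatching_edgesOf.1 hN
    have hvotes := h g hg
    rw [← Market.votes_sub_votes hf hg, sub_nonpos] at hvotes
    exact_mod_cast hvotes

end Popularity

section Certificates

variable {m n : ℕ} {I J : Market m n} {R : Fin m → Fin n → Fin n → Prop}
  {f : Fin m → Option (Fin n)} {π : Fin n → ℕ}

/-- The levels `π` certify that the assignment `f` is popular when agent `a` has the preference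
relation `R a`: they are dual prices of the jobs for the assignment problem of maximizing `gain`. -/
structure Certificate (I : Market m n) (R : Fin m → Fin n → Fin n → Prop)
    (f : Fin m → Option (Fin n)) (π : Fin n → ℕ) : Prop where
  assignment : I.IsAssignment f
  le_two : ∀ b, π b ≤ 2
  lt_of_rel : ∀ {a b c}, f a = some b → I.Edge a c → c ≠ b → R a c b → π b < π c
  le_succ : ∀ {a b c}, f a = some b → I.Edge a c → c ≠ b → π b ≤ π c + 1
  two_le : ∀ {a c}, f a = none → I.Edge a c → 2 ≤ π c
  exists_eq_some : ∀ {b}, π b ≠ 0 → ∃ a, f a = some b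

namespace Certificate

theorem gain_le (h : Certificate I R f π) {S : Fin m → Fin n → Fin n → Prop}
    (hS : ∀ a b c, S a b c → R a b c) {g : Fin m → Option (Fin n)} (hg : I.IsAssignment g)
    (a : Fin m) :
    gain (S a) (g a) (f a) ≤
      (g a).elim 0 (fun b => (π b : ℤ)) - (f a).elim 0 (fun b => (π b : ℤ)) := by
  rcases hga : g a with _ | b <;> rcases hfa : f a with _ | c
  · simp
  · have := h.le_two c
    simp only [gain, Option.elim]
    omega
  · have := h.two_le hfa (hg.edge hga)
    simp only [gain, Option.elim]
    omega
  · rcases eq_or_ne b c with rfl | hbc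
    · simp
    · have hle := h.le_succ hfa (hg.edge hga) hbc
      have hlt := fun hSbc => h.lt_of_rel hfa (hg.edge hga) hbc (hS a b c hSbc)
      simp only [gain, if_neg hbc, Option.elim]
      split_ifs with hSbc
      · have := hlt hSbc
        omega
      · omega

theorem sum_gain_nonpos (h : Certificate I R f π) {S : Fin m → Fin n → Fin n → Prop}
    (hS : ∀ a b c, S a b c → R a b c) {g : Fin m → Option (Fin n)} (hg : I.IsAssignment g) :
    ∑ a, gain (S a) (g a) (f a) ≤ 0 := by
  classical
  refine (Finset.sum_le_sum fun a _ => h.gain_le hS hg a).trans ?_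
  rw [Finset.sum_sub_distrib, hg.sum_elim, h.assignment.sum_elim, ← Finset.sum_sub_distrib]
  refine Finset.sum_nonpos fun b _ => ?_
  by_cases hb : π b = 0
  · simp [hb]
  · rw [if_pos (h.exists_eq_some hb)]
    split_ifs <;> simp

end Certificate

section ExistsCertificate

/-- The job of a slot. The slots are the jobs and one outside option for each agent; they make every
assignment total. -/
def slotJob : Fin n ⊕ Fin m → Option (Fin n)
  | .inl b => some b
  | .inr _ => none

/-- The slot that an agent holds under an assignment of jobs. -/
def slotOf (f : Fin m → Option (Fin n)) (a : Fin m) : Fin n ⊕ Fin m := (f a).elim (.inr a) .inl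

/-- The slots open to an agent: her neighbours and her own outside option. -/
def Market.SlotEdge (I : Market m n) (a : Fin m) : Fin n ⊕ Fin m → Prop
  | .inl b => I.Edge a b
  | .inr a' => a' = a

@[simp]
theorem slotJob_slotOf (f : Fin m → Option (Fin n)) (a : Fin m) : slotJob (slotOf f a) = f a := by
  unfold slotOf
  cases f a <;> rfl

theorem slotOf_of_eq_some {a : Fin m} {b : Fin n} (h : f a = some b) : slotOf f a = .inl b := by
  simp [slotOf, h]

theorem slotOf_of_eq_none {a : Fin m} (h : f a = none) : slotOf f a = .inr a := by
  simp [slotOf, h]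

theorem eq_of_slotOf_eq_inr {a a' : Fin m} (h : slotOf f a' = .inr a) : a' = a ∧ f a = none := by
  rcases hfa : f a' with _ | b
  · rw [slotOf_of_eq_none hfa, Sum.inr.injEq] at h
    exact ⟨h, h ▸ hfa⟩
  · simp [slotOf_of_eq_some hfa] at h

theorem Market.IsAssignment.slotOf_injective (hf : I.IsAssignment f) :
    Function.Injective (slotOf f) := by
  intro a a' h
  rcases hfa : f a with _ | b
  · rw [slotOf_of_eq_none hfa] at h
    exact (eq_of_slotOf_eq_inr h.symm).1.symm
  · refine hf.inj hfa ?_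
    rw [← slotJob_slotOf f a', ← h, slotJob_slotOf, hfa]

theorem Market.IsAssignment.slotEdge_slotOf (hf : I.IsAssignment f) (a : Fin m) :
    I.SlotEdge a (slotOf f a) := by
  rcases hfa : f a with _ | b
  · rw [slotOf_of_eq_none hfa]
    exact rfl
  · rw [slotOf_of_eq_some hfa]
    exact hf.edge hfa

theorem Market.isAssignment_slotJob {F : Fin m → Fin n ⊕ Fin m} (hF : Function.Injective F)
    (hI : ∀ a, I.SlotEdge a (F a)) : I.IsAssignment fun a => slotJob (F a) := by
  have hinl : ∀ {a b}, slotJob (F a) = some b → F a = .inl b := fun {a b} h => by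
    rcases hs : F a with b' | a' <;> simp_all [slotJob]
  exact ⟨fun {a b} h => by simpa [hinl h, Market.SlotEdge] using hI a,
    fun h h' => hF ((hinl h).trans (hinl h').symm)⟩

/-- The gain from moving the holder of slot `s` to slot `s'`; it is `0` if slot `s` has no
holder. -/
noncomputable def moveGain (R : Fin m → Fin n → Fin n → Prop) (f : Fin m → Option (Fin n))
    (s s' : Fin n ⊕ Fin m) : ℤ :=
  ∑ a with slotOf f a = s, gain (R a) (slotJob s') (f a)

theorem moveGain_self (s : Fin n ⊕ Fin m) : moveGain R f s s = 0 := by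
  refine Finset.sum_eq_zero fun a ha => ?_
  rw [← (Finset.mem_filter.1 ha).2, slotJob_slotOf, gain_self]

theorem Market.IsAssignment.moveGain_slotOf (hf : I.IsAssignment f) (a : Fin m)
    (s : Fin n ⊕ Fin m) : moveGain R f (slotOf f a) s = gain (R a) (slotJob s) (f a) := by
  simp [moveGain, hf.slotOf_injective.eq_iff, Finset.filter_eq']

theorem moveGain_of_unheld {s : Fin n ⊕ Fin m} (hs : ∀ a, slotOf f a ≠ s) (s' : Fin n ⊕ Fin m) :
    moveGain R f s s' = 0 := by
  simp [moveGain, hs]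

theorem sum_moveGain (σ : Fin n ⊕ Fin m → Fin n ⊕ Fin m) :
    ∑ s, moveGain R f s (σ s) = ∑ a, gain (R a) (slotJob (σ (slotOf f a))) (f a) := by
  simp only [moveGain, Finset.sum_filter]
  rw [Finset.sum_comm]
  simp

/-- Linear programming duality: improving exchanges of slots along a permutation are excluded, hence
the exchanges admit a potential. -/
theorem exists_moveGain_potential (hf : I.IsAssignment f)
    (hopt : ∀ g, I.IsAssignment g → ∑ a, gain (R a) (g a) (f a) ≤ 0) :
    ∃ p : Fin n ⊕ Fin m → ℤ, ∀ s s', (∀ a, slotOf f a = s → I.SlotEdge a s') →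
      p s + moveGain R f s s' ≤ p s' := by
  refine exists_potential_of_perm_nonpos
    (r := fun s s' => ∀ a, slotOf f a = s → I.SlotEdge a s') moveGain_self fun σ hσ => ?_
  rw [sum_moveGain]
  refine hopt _ (Market.isAssignment_slotJob (σ.injective.comp hf.slotOf_injective) fun a => ?_)
  rcases hσ (slotOf f a) with h | h
  · simpa [h] using hf.slotEdge_slotOf a
  · exact h a rfl

/-- Every exchange out of a slot without holder is allowed and has gain `0`, so that these slots
have the lowest potential. -/
theorem exists_slot_levels (hf : I.IsAssignment f)
    (hopt : ∀ g, I.IsAssignment g → ∑ a, gain (R a) (g a) (f a) ≤ 0) :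
    ∃ p : Fin n ⊕ Fin m → ℕ, (∀ s, (∀ a, slotOf f a ≠ s) → p s = 0) ∧
      ∀ a s, I.SlotEdge a s → p (slotOf f a) + gain (R a) (slotJob s) (f a) ≤ p s := by
  obtain ⟨p, hp⟩ := exists_moveGain_potential hf hopt
  obtain ⟨u₀, hu₀⟩ | hnone := exists_or_forall_not fun u => ∀ a, slotOf f a ≠ u
  · have unheld_le : ∀ u s, (∀ a, slotOf f a ≠ u) → p u ≤ p s := fun u s hu => by
      have := hp u s fun a ha => absurd ha (hu a)
      rwa [moveGain_of_unheld hu, add_zero] at this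
    have toNat_sub : ∀ s, ((p s - p u₀).toNat : ℤ) = p s - p u₀ := fun s =>
      Int.toNat_of_nonneg (sub_nonneg.2 (unheld_le u₀ s hu₀))
    refine ⟨fun s => (p s - p u₀).toNat, fun s hs => ?_, fun a s has => ?_⟩
    · exact Int.toNat_eq_zero.2 (sub_nonpos.2 (unheld_le s u₀ hs))
    · have := hp (slotOf f a) s fun a' ha' => hf.slotOf_injective ha' ▸ has
      rw [hf.moveGain_slotOf] at this
      rw [toNat_sub, toNat_sub]
      linarith
  · have hsurj : Function.Surjective (slotOf f) := fun s => by simpa using hnone s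
    have hn : n = 0 := by simpa using Fintype.card_le_of_surjective _ hsurj
    subst hn
    have isEmpty_job : ∀ x y : Option (Fin 0), x = y := fun x y => Subsingleton.elim x y
    exact ⟨0, fun _ _ => rfl, fun a s _ => by simp [isEmpty_job (slotJob s) (f a)]⟩

theorem exists_certificate (hf : I.IsAssignment f)
    (hopt : ∀ g, I.IsAssignment g → ∑ a, gain (R a) (g a) (f a) ≤ 0) :
    ∃ π, Certificate I R f π := by
  obtain ⟨p, hunheld, hp⟩ := exists_slot_levels hf hopt
  have exists_holder : ∀ {b}, p (.inl b) ≠ 0 → ∃ a, f a = some b := fun {b} hb => by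
    by_contra hcon
    push Not at hcon
    refine hb (hunheld _ fun a ha => hcon a ?_)
    rw [← slotJob_slotOf f a, ha, slotJob]
  have step : ∀ {a b c}, f a = some b → I.Edge a c →
      p (.inl b) + gain (R a) (some c) (some b) ≤ p (.inl c) := fun {a b c} hab hac => by
    simpa only [slotOf_of_eq_some hab, hab, slotJob] using hp a (.inl c) hac
  refine ⟨fun b => p (.inl b), hf, fun b => ?_, fun {a b c} hab hac hcb hR => ?_,
    fun {a b c} hab hac hcb => ?_, fun {a c} ha hac => ?_, exists_holder⟩
  · rcases Nat.eq_zero_or_pos (p (.inl b)) with hb | hb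
    · omega
    · obtain ⟨a, hab⟩ := exists_holder hb.ne'
      have houtside : p (.inr a) = 0 := hunheld _ fun a' ha' => by
        simpa [hab] using (eq_of_slotOf_eq_inr ha').2
      have := hp a (.inr a) rfl
      simp only [slotOf_of_eq_some hab, hab, slotJob, gain, houtside] at this
      omega
  · have := step hab hac
    simp only [gain, if_neg hcb, if_pos hR] at this
    omega
  · have := step hab hac
    simp only [gain, if_neg hcb] at this
    split_ifs at this <;> omega
  · have := hp a (.inl c) hac
    simp only [slotOf_of_eq_none ha, ha, slotJob, gain] at this
    omega

end ExistsCertificate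

/-- Agent `a` ranks `b` strictly above `c` in one of the two instances. -/
def Market.AboveEither (I J : Market m n) (a : Fin m) (b c : Fin n) : Prop :=
  I.Above a b c ∨ J.Above a b c

/-- Only one agent can have different votes in the two instances and in their union, and her vote in
the union agrees with one of the other two. -/
theorem Market.sum_gain_aboveEither (hIJ : ∃ a₀, ∀ a, a ≠ a₀ → I.list a = J.list a)
    (g f : Fin m → Option (Fin n)) :
    ∑ a, gain (I.AboveEither J a) (g a) (f a) = ∑ a, gain (I.Above a) (g a) (f a) ∨
      ∑ a, gain (I.AboveEither J a) (g a) (f a) = ∑ a, gain (J.Above a) (g a) (f a) := by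
  obtain ⟨a₀, hlist⟩ := hIJ
  have above_eq : ∀ a ≠ a₀, J.Above a = I.Above a := fun a ha => by
    funext b c
    simp only [Market.Above, Market.Edge, hlist a ha]
  have either_eq : ∀ a ≠ a₀, I.AboveEither J a = I.Above a := fun a ha => by
    funext b c
    simp only [Market.AboveEither, above_eq a ha, or_self]
  rcases gain_or (I.Above a₀) (J.Above a₀) (g a₀) (f a₀) with h | h
  · refine Or.inl (Finset.sum_congr rfl fun a _ => ?_)
    rcases eq_or_ne a a₀ with rfl | ha
    · exact h
    · rw [either_eq a ha]
  · refine Or.inr (Finset.sum_congr rfl fun a _ => ?_)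
    rcases eq_or_ne a a₀ with rfl | ha
    · exact h
    · rw [either_eq a ha, above_eq a ha]

theorem Market.DifferInOneAgent.isAssignment_iff (hIJ : I.DifferInOneAgent J) :
    J.IsAssignment f ↔ I.IsAssignment f :=
  ⟨fun h => ⟨fun hab => (hIJ.1 _ _).2 (h.edge hab), h.inj⟩,
    fun h => ⟨fun hab => (hIJ.1 _ _).1 (h.edge hab), h.inj⟩⟩

theorem Market.DifferInOneAgent.isRobustPopular_edgesOf (hIJ : I.DifferInOneAgent J) :
    I.IsRobustPopular J (edgesOf f) ↔ ∃ π, Certificate I (I.AboveEither J) f π := by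
  simp only [Market.IsRobustPopular, Market.isPopular_edgesOf, hIJ.isAssignment_iff]
  constructor
  · rintro ⟨⟨hf, hI⟩, -, hJ⟩
    refine exists_certificate hf fun g hg => ?_
    rcases Market.sum_gain_aboveEither hIJ.2 g f with h | h <;> rw [h]
    · exact hI g hg
    · exact hJ g hg
  · rintro ⟨π, h⟩
    exact ⟨⟨h.assignment, fun _ => h.sum_gain_nonpos fun _ _ _ => Or.inl⟩,
      h.assignment, fun _ => h.sum_gain_nonpos fun _ _ _ => Or.inr⟩

end Certificates

section Auction

theorem exists_rel_of_forall_exists_rel {α : Type*} {T : α → α → Prop} {Q : Finset α}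
    (hT : ∀ x ∈ Q, ∃ y ∈ Q, T x y)
    (hinj : ∀ x ∈ Q, ∀ x' ∈ Q, ∀ y, T x y → T x' y → x = x') : ∀ y ∈ Q, ∃ x ∈ Q, T x y := by
  choose! t ht hTt using hT
  intro y hy
  obtain ⟨x, hx, rfl⟩ := Finset.surjOn_of_injOn_of_card_le t ht
    (fun x hx x' hx' h => hinj x hx x' hx' _ (hTt x hx) (h ▸ hTt x' hx')) le_rfl hy
  exact ⟨x, hx, hTt x hx⟩

variable {m n : ℕ} {rk : ℕ → ℕ → ℕ}

/-- The tables of ranks for which the auction is correct. Row `a` holds the ranks of agent `a` in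
the first instance and row `m + a` those in the second; rank `0` means that there is no edge. The
slots, which index the columns, are the jobs `b < n` and the outside options `n + a` of the
agents. -/
structure RankTable (m n : ℕ) (rk : ℕ → ℕ → ℕ) : Prop where
  ne : ∀ a < m, ∀ b < n, ∀ c < n, rk a b ≠ 0 → b ≠ c → rk a b ≠ rk a c
  le : ∀ a < m, ∀ b < n, rk a b ≤ n
  own : ∀ a < m, rk a (n + a) = n + 1
  other : ∀ a < m, ∀ a' < m, a' ≠ a → rk a (n + a') = 0

/-- The condition that job `b` imposes on agent `a` holding slot `s` at the levels `U`. -/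
def JobClause (m : ℕ) (rk : ℕ → ℕ → ℕ) (U : ℕ → ℕ) (a s b : ℕ) : Prop :=
  rk a b ≠ 0 → b ≠ s →
    if rk a b < rk a s ∨ rk (m + a) b < rk (m + a) s then U s < U b else U s ≤ U b + 1

/-- Slot `s` may be given to agent `a` in a certificate with levels `U`. -/
def Usable (m n : ℕ) (rk : ℕ → ℕ → ℕ) (U : ℕ → ℕ) (a s : ℕ) : Prop :=
  rk a s ≠ 0 ∧ ∀ b < n, JobClause m rk U a s b

/-- The admissible level functions. Outside options have level `1`, so that the clauses of an agent
who holds hers require level `2` of all her neighbours. -/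
structure Levels (m n : ℕ) (U : ℕ → ℕ) : Prop where
  le_two : ∀ b < n, U b ≤ 2
  out : ∀ a < m, U (n + a) = 1

/-- A certificate in terms of slots: agent `a` holds slot `f a`, at the levels `π`. -/
structure Solution (m n : ℕ) (rk : ℕ → ℕ → ℕ) (f π : ℕ → ℕ) : Prop where
  levels : Levels m n π
  lt : ∀ a < m, f a < n + m
  usable : ∀ a < m, Usable m n rk π a (f a)
  inj : ∀ a < m, ∀ a' < m, f a = f a' → a = a'
  cover : ∀ b < n, π b ≠ 0 → ∃ a < m, f a = b

/-- Levels that bound those of every solution from above. -/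
structure UpperLevels (m n : ℕ) (rk : ℕ → ℕ → ℕ) (U : ℕ → ℕ) : Prop where
  levels : Levels m n U
  bound : ∀ f π, Solution m n rk f π → ∀ b < n, π b ≤ U b

/-- Agent `a` may bid for slot `s`. The auction has two phases: in phase `0` only the jobs of
positive level, which have to be covered, are for sale, afterwards all slots are. -/
def Eligible (m n : ℕ) (rk : ℕ → ℕ → ℕ) (U : ℕ → ℕ) (ph a s : ℕ) : Prop :=
  (ph ≠ 0 ∨ s < n ∧ U s ≠ 0) ∧ Usable m n rk U a s

/-- The state of the auction in phase `ph` at the levels `U`: agent `a` holds slot `g a - 1`, and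
none if `g a = 0`; slot `s` is held by agent `o s - 1`, and by nobody if `o s = 0`; its price is
`p s`. -/
structure AuctionState (m n : ℕ) (rk : ℕ → ℕ → ℕ) (U : ℕ → ℕ) (ph : ℕ) (g o p : ℕ → ℕ) :
    Prop where
  holds_iff : ∀ a < m, ∀ s < n + m, g a = s + 1 ↔ o s = a + 1
  slot_le : ∀ a < m, g a ≤ n + m
  owner_le : ∀ s < n + m, o s ≤ m
  eligible : ∀ a < m, ∀ s, g a = s + 1 → Eligible m n rk U ph a s
  price_eq_zero : ∀ s < n + m, o s = 0 → p s = 0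
  price_le : ∀ s < n + m, p s ≤ m + 2
  slack : ∀ a < m, ∀ s, g a = s + 1 → ∀ s' < n + m, Eligible m n rk U ph a s' → p s ≤ p s' + 1
  cover : ph ≠ 0 → ∀ b < n, U b ≠ 0 → o b ≠ 0

/-- The auction has come to a standstill: for agents without slot every eligible slot has reached
the maximal price. -/
def NoBid (m n : ℕ) (rk : ℕ → ℕ → ℕ) (U : ℕ → ℕ) (ph : ℕ) (g p : ℕ → ℕ) : Prop :=
  ∀ a < m, g a = 0 → ∀ s < n + m, Eligible m n rk U ph a s → m + 2 ≤ p s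

/-- Agent `a` has no slot or one whose price exceeds `j`. -/
def PricedOut (g p : ℕ → ℕ) (j a : ℕ) : Prop := ∀ s, g a = s + 1 → j < p s

theorem Usable.of_level_eq {U π : ℕ → ℕ} {a s : ℕ} (h : Usable m n rk π a s) (hs : π s = U s)
    (hle : ∀ b < n, π b ≤ U b) : Usable m n rk U a s := by
  refine ⟨h.1, fun b hb hab hne => ?_⟩
  have hclause := h.2 b hb hab hne
  have := hle b hb
  split_ifs at * <;> omega

theorem Usable.job_or_own (hR : RankTable m n rk) {U : ℕ → ℕ} {a s : ℕ} (ha : a < m)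
    (hs : s < n + m) (h : Usable m n rk U a s) : s < n ∨ s = n + a := by
  by_contra hcon
  push Not at hcon
  obtain ⟨a', rfl⟩ := Nat.exists_eq_add_of_le hcon.1
  exact h.1 (hR.other a ha a' (by omega) (by omega))

theorem Levels.eq_of_ge {U π : ℕ → ℕ} (hU : Levels m n U) (hπ : Levels m n π) {s : ℕ}
    (hns : n ≤ s) (hs : s < n + m) : π s = U s := by
  obtain ⟨a, rfl⟩ := Nat.exists_eq_add_of_le hns
  rw [hU.out a (by omega), hπ.out a (by omega)]

theorem Usable.level_eq (hR : RankTable m n rk) {U π : ℕ → ℕ} (hU : Levels m n U)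
    (hπ : Levels m n π) (hle : ∀ b < n, π b ≤ U b) {a s s' : ℕ} (ha : a < m) (hs : s < n + m)
    (hs' : s' < n + m) (h : Usable m n rk π a s) (heq : π s = U s) (h' : Usable m n rk U a s') :
    π s' = U s' := by
  rcases Nat.lt_or_ge s' n with hs'n | hns'
  · by_contra hne
    have hlt : π s' < U s' := lt_of_le_of_ne (hle s' hs'n) hne
    have hss' : s' ≠ s := by
      rintro rfl
      exact hne heq
    have hclause := h.2 s' hs'n h'.1 hss'
    rcases h.job_or_own hR ha hs with hsn | rfl
    · have hclause' := h'.2 s hsn h.1 hss'.symm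
      have hrank := hR.ne a ha s hsn s' hs'n h.1 hss'.symm
      split_ifs at hclause hclause' <;> omega
    · have hrank : rk a s' < rk a (n + a) := by
        rw [hR.own a ha]
        exact Nat.lt_succ_of_le (hR.le a ha s' hs'n)
      rw [if_pos (Or.inl hrank), hπ.out a ha] at hclause
      have := hU.le_two s' hs'n
      omega
  · exact hU.eq_of_ge hπ hns' hs'

namespace AuctionState

variable {U g o p : ℕ → ℕ} {ph : ℕ}

theorem slot_inj (h : AuctionState m n rk U ph g o p) {a a' s : ℕ} (ha : a < m) (ha' : a' < m)
    (hs : g a = s + 1) (hs' : g a' = s + 1) : a = a' := by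
  have hsn : s < n + m := by
    have := h.slot_le a ha
    omega
  have := (h.holds_iff a ha s hsn).1 hs
  have := (h.holds_iff a' ha' s hsn).1 hs'
  omega

theorem exists_holder (h : AuctionState m n rk U ph g o p) {s : ℕ} (hs : s < n + m)
    (ho : o s ≠ 0) : ∃ a < m, g a = s + 1 := by
  have := h.owner_le s hs
  exact ⟨o s - 1, by omega, (h.holds_iff _ (by omega) s hs).2 (by omega)⟩

theorem owner_inj (h : AuctionState m n rk U ph g o p) {s s' : ℕ} (hs : s < n + m)
    (hs' : s' < n + m) (ho : o s ≠ 0) (heq : o s = o s') : s = s' := by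
  obtain ⟨a, ha, hga⟩ := h.exists_holder hs ho
  have := (h.holds_iff a ha s' hs').2 (heq ▸ (h.holds_iff a ha s hs).1 hga)
  omega

/-- Slots with positive price are held, and there are fewer agents than prices. -/
theorem exists_unused_price (h : AuctionState m n rk U ph g o p) :
    ∃ j ≤ m + 1, ∀ s < n + m, p s ≠ j := by
  by_contra hcon
  push Not at hcon
  choose! slot hslot hprice using hcon
  have held : ∀ j ∈ Finset.Icc 1 (m + 1), o (slot j) ≠ 0 := fun j hj ho => by
    rw [Finset.mem_Icc] at hj
    have := h.price_eq_zero _ (hslot j hj.2) ho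
    have := hprice j hj.2
    omega
  have maps_to : ∀ j ∈ Finset.Icc 1 (m + 1), o (slot j) ∈ Finset.Icc 1 m := fun j hj =>
    Finset.mem_Icc.2 ⟨Nat.one_le_iff_ne_zero.2 (held j hj),
      h.owner_le _ (hslot j (Finset.mem_Icc.1 hj).2)⟩
  obtain ⟨j, hj, j', hj', hne, heq⟩ :=
    Finset.exists_ne_map_eq_of_card_lt_of_maps_to (by simp) maps_to
  have hlej := (Finset.mem_Icc.1 hj).2
  have hlej' := (Finset.mem_Icc.1 hj').2
  have hslots := h.owner_inj (hslot j hlej) (hslot j' hlej') (held j hj) heq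
  exact hne (by rw [← hprice j hlej, hslots, hprice j' hlej'])

/-- Prices that an agent pays and those of her eligible slots differ by at most one, hence an unused
price separates the two kinds of agents. -/
theorem exists_threshold (h : AuctionState m n rk U ph g o p) (hno : NoBid m n rk U ph g p) :
    ∃ j, ∀ a < m, PricedOut g p j a → ∀ s < n + m, Eligible m n rk U ph a s → j < p s := by
  obtain ⟨j, hjm, hj⟩ := h.exists_unused_price
  refine ⟨j, fun a ha hout s hs he => ?_⟩
  have hne := hj s hs
  rcases Nat.eq_zero_or_pos (g a) with hfree | hheld
  · have := hno a ha hfree s hs he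
    omega
  · obtain ⟨s₀, hs₀⟩ := Nat.exists_eq_add_one_of_ne_zero hheld.ne'
    have := h.slack a ha s₀ hs₀ s hs he
    have := hout s₀ hs₀
    omega

/-- In phase `0` the agent who holds `s` in a solution holds a slot of the same kind as `s`. -/
theorem exists_exchange_of_tight (h : AuctionState m n rk U 0 g o p) (hR : RankTable m n rk)
    (hU : UpperLevels m n rk U) {f π : ℕ → ℕ} (hf : Solution m n rk f π) {j : ℕ}
    (hj : ∀ a < m, PricedOut g p j a → ∀ s < n + m, Eligible m n rk U 0 a s → j < p s)
    {s : ℕ} (hsn : s < n) (hπ : π s = U s) (hUs : U s ≠ 0) (hps : p s ≤ j) :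
    ∃ s' < n, (π s' = U s' ∧ U s' ≠ 0 ∧ p s' ≤ j) ∧ ∃ a < m, f a = s ∧ g a = s' + 1 := by
  have hle := hU.bound f π hf
  obtain ⟨a, ha, rfl⟩ := hf.cover s hsn (by omega)
  have husable := hf.usable a ha
  have heligible : Eligible m n rk U 0 a (f a) :=
    ⟨Or.inr ⟨hsn, hUs⟩, husable.of_level_eq hπ hle⟩
  have hin : ¬ PricedOut g p j a := fun hout =>
    (hj a ha hout (f a) (by omega) heligible).not_ge hps
  simp only [PricedOut, not_forall, not_lt] at hin
  obtain ⟨s', hgs', hps'⟩ := hin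
  have heligible' := h.eligible a ha s' hgs'
  have hs'n := heligible'.1.resolve_left (by simp)
  exact ⟨s', hs'n.1, ⟨husable.level_eq hR hU.levels hf.levels hle ha (hf.lt a ha) (by omega) hπ
    heligible'.2, hs'n.2, hps'⟩, a, ha, rfl, hgs'⟩

theorem lt_level_of_uncovered (h : AuctionState m n rk U ph g o p) (hR : RankTable m n rk)
    (hU : UpperLevels m n rk U) (hno : NoBid m n rk U ph g p) {f π : ℕ → ℕ}
    (hf : Solution m n rk f π) {b : ℕ} (hb : b < n) (hUb : U b ≠ 0) (hob : o b = 0) :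
    π b < U b := by
  refine lt_of_le_of_ne (hU.bound f π hf b hb) fun heq => ?_
  obtain rfl : ph = 0 := by
    by_contra hph
    exact h.cover hph b hb hUb hob
  obtain ⟨j, hj⟩ := h.exists_threshold hno
  let tight := {s ∈ Finset.range n | π s = U s ∧ U s ≠ 0 ∧ p s ≤ j}
  have mem_tight : ∀ {s}, s ∈ tight ↔ s < n ∧ π s = U s ∧ U s ≠ 0 ∧ p s ≤ j := by simp [tight]
  have hbtight : b ∈ tight := mem_tight.2 ⟨hb, heq, hUb, by
    rw [h.price_eq_zero b (by omega) hob]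
    exact Nat.zero_le j⟩
  obtain ⟨s, -, a, ha, -, hga⟩ := exists_rel_of_forall_exists_rel
    (T := fun s s' => ∃ a < m, f a = s ∧ g a = s' + 1)
    (fun s hs => by
      obtain ⟨hsn, hπ, hUs, hps⟩ := mem_tight.1 hs
      obtain ⟨s', hs'n, hs', hex⟩ := h.exists_exchange_of_tight hR hU hf hj hsn hπ hUs hps
      exact ⟨s', mem_tight.2 ⟨hs'n, hs'⟩, hex⟩)
    (by
      rintro s - s' - t ⟨a, ha, rfl, hga⟩ ⟨a', ha', rfl, hga'⟩
      rw [h.slot_inj ha ha' hga hga']) b hbtight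
  have := (h.holds_iff a ha b (by omega)).1 hga
  omega

theorem exists_slot_of_level_ne (h : AuctionState m n rk U ph g o p) (hR : RankTable m n rk)
    (hU : UpperLevels m n rk U) (hph : ph ≠ 0) {f π : ℕ → ℕ} (hf : Solution m n rk f π) {a : ℕ}
    (ha : a < m) (hne : π (f a) ≠ U (f a)) : ∃ s < n, π s ≠ U s ∧ g a = s + 1 := by
  have hle := hU.bound f π hf
  let loose := {s ∈ Finset.range n | π s ≠ U s}
  have mem_loose : ∀ {s}, s ∈ loose ↔ s < n ∧ π s ≠ U s := by simp [loose]
  have lt_of_ne : ∀ {s}, s < n + m → π s ≠ U s → s < n := fun hs hne =>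
    lt_of_not_ge fun hns => hne (hU.levels.eq_of_ge hf.levels hns hs)
  obtain ⟨s, hs, a', ha', hga', hfa'⟩ := exists_rel_of_forall_exists_rel
    (T := fun s s' => ∃ a < m, g a = s + 1 ∧ f a = s') (Q := loose)
    (fun s hs => by
      obtain ⟨hsn, hsne⟩ := mem_loose.1 hs
      have := hle s hsn
      obtain ⟨a, ha, hga⟩ := h.exists_holder (s := s) (by omega) (h.cover hph s hsn (by omega))
      have hfa : π (f a) ≠ U (f a) := fun heq => hsne <|
        (hf.usable a ha).level_eq hR hU.levels hf.levels hle ha (hf.lt a ha) (by omega) heq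
          (h.eligible a ha s hga).2
      exact ⟨f a, mem_loose.2 ⟨lt_of_ne (hf.lt a ha) hfa, hfa⟩, a, ha, hga, rfl⟩)
    (by
      rintro s - s' - t ⟨a, ha, hga, hfa⟩ ⟨a', ha', hga', hfa'⟩
      obtain rfl := hf.inj a ha a' ha' (hfa.trans hfa'.symm)
      omega)
    (f a) (mem_loose.2 ⟨lt_of_ne (hf.lt a ha) hne, hne⟩)
  obtain rfl := hf.inj a' ha' a ha hfa'
  exact ⟨s, (mem_loose.1 hs).1, (mem_loose.1 hs).2, hga'⟩

/-- The slot of a priced out agent in a solution is held by an agent who is priced out, too. -/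
theorem exists_pricedOut_holder (h : AuctionState m n rk U ph g o p) (hR : RankTable m n rk)
    (hU : UpperLevels m n rk U) (hph : ph ≠ 0) {f π : ℕ → ℕ} (hf : Solution m n rk f π) {j : ℕ}
    (hj : ∀ a < m, PricedOut g p j a → ∀ s < n + m, Eligible m n rk U ph a s → j < p s)
    {a : ℕ} (ha : a < m) (heq : π (f a) = U (f a)) (hout : PricedOut g p j a) :
    ∃ a' < m, (π (f a') = U (f a') ∧ PricedOut g p j a') ∧ g a' = f a + 1 := by
  have hfa := hf.lt a ha
  have hprice := hj a ha hout (f a) hfa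
    ⟨Or.inl hph, (hf.usable a ha).of_level_eq heq (hU.bound f π hf)⟩
  obtain ⟨a', ha', hga'⟩ := h.exists_holder hfa fun ho => by
    have := h.price_eq_zero _ hfa ho
    omega
  refine ⟨a', ha', ⟨?_, fun s hs => ?_⟩, hga'⟩
  · by_contra hne
    obtain ⟨s, -, hs, hgs⟩ := h.exists_slot_of_level_ne hR hU hph hf ha' hne
    obtain rfl : s = f a := by omega
    exact hs heq
  · obtain rfl : s = f a := by omega
    exact hprice

theorem not_solution_of_free (h : AuctionState m n rk U ph g o p) (hR : RankTable m n rk)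
    (hU : UpperLevels m n rk U) (hno : NoBid m n rk U ph g p) (hph : ph ≠ 0) {a₀ : ℕ}
    (ha₀ : a₀ < m) (hg₀ : g a₀ = 0) (f π : ℕ → ℕ) : ¬ Solution m n rk f π := by
  classical
  intro hf
  obtain ⟨j, hj⟩ := h.exists_threshold hno
  let stuck := {a ∈ Finset.range m | π (f a) = U (f a) ∧ PricedOut g p j a}
  have mem_stuck : ∀ {a}, a ∈ stuck ↔ a < m ∧ π (f a) = U (f a) ∧ PricedOut g p j a := by
    simp [stuck]
  have ha₀stuck : a₀ ∈ stuck := by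
    refine mem_stuck.2 ⟨ha₀, ?_, fun s hs => by omega⟩
    by_contra hne
    obtain ⟨s, -, -, hgs⟩ := h.exists_slot_of_level_ne hR hU hph hf ha₀ hne
    omega
  obtain ⟨a, -, hga⟩ := exists_rel_of_forall_exists_rel (T := fun a a' => g a' = f a + 1)
    (fun a ha => by
      obtain ⟨ham, heq, hout⟩ := mem_stuck.1 ha
      obtain ⟨a', ha'm, ha', hga'⟩ := h.exists_pricedOut_holder hR hU hph hf hj ham heq hout
      exact ⟨a', mem_stuck.2 ⟨ha'm, ha'⟩, hga'⟩)
    (fun a ha a' ha' s hs hs' =>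
      hf.inj a (mem_stuck.1 ha).1 a' (mem_stuck.1 ha').1 (by omega)) a₀ ha₀stuck
  omega

theorem solution (h : AuctionState m n rk U ph g o p) (hU : Levels m n U) (hph : ph ≠ 0)
    (hall : ∀ a < m, g a ≠ 0) : Solution m n rk (fun a => g a - 1) U where
  levels := hU
  lt a ha := by
    have := h.slot_le a ha
    have := hall a ha
    omega
  usable a ha := (h.eligible a ha _ (Nat.succ_pred (hall a ha)).symm).2
  inj a ha a' ha' heq := by
    have := hall a ha
    have := hall a' ha'
    exact h.slot_inj (s := g a - 1) ha ha' (by omega) (by omega)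
  cover b hb hUb := by
    obtain ⟨a, ha, hga⟩ := h.exists_holder (s := b) (by omega) (h.cover hph b hb hUb)
    exact ⟨a, ha, by simp [hga]⟩

theorem reset (U : ℕ → ℕ) (hg : ∀ a < m, g a = 0) (ho : ∀ s < n + m, o s = 0)
    (hp : ∀ s < n + m, p s = 0) : AuctionState m n rk U 0 g o p where
  holds_iff a ha s hs := by simp [hg a ha, ho s hs]
  slot_le a ha := by simp [hg a ha]
  owner_le s hs := by simp [ho s hs]
  eligible a ha s h := by simp [hg a ha] at h
  price_eq_zero s hs _ := hp s hs
  price_le s hs := by simp [hp s hs]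
  slack a ha s h := by simp [hg a ha] at h
  cover h := absurd rfl h

theorem next_phase (h : AuctionState m n rk U ph g o p) (hcov : ∀ b < n, U b ≠ 0 → o b ≠ 0)
    {p' : ℕ → ℕ} (hp : ∀ s < n + m, p' s = 0) : AuctionState m n rk U 1 g o p' where
  holds_iff := h.holds_iff
  slot_le := h.slot_le
  owner_le := h.owner_le
  eligible a ha s hs := ⟨Or.inl one_ne_zero, (h.eligible a ha s hs).2⟩
  price_eq_zero s hs _ := hp s hs
  price_le s hs := by simp [hp s hs]
  slack a ha s hs s' _ _ := by
    have := h.slot_le a ha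
    simp [hp s (by omega)]
  cover _ := hcov

theorem bid (h : AuctionState m n rk U ph g o p) {a₀ s₀ : ℕ} (ha₀ : a₀ < m) (hs₀ : s₀ < n + m)
    (hg₀ : g a₀ = 0) (he : Eligible m n rk U ph a₀ s₀) (hp : p s₀ < m + 2)
    (hmin : ∀ s < n + m, Eligible m n rk U ph a₀ s → p s₀ ≤ p s) :
    AuctionState m n rk U ph
      (fun a => if a = a₀ then s₀ + 1 else if o s₀ = a + 1 then 0 else g a)
      (Function.update o s₀ (a₀ + 1)) (Function.update p s₀ (p s₀ + 1)) where
  holds_iff a ha s hs := by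
    have := h.holds_iff a ha s hs
    have := h.holds_iff a ha s₀ hs₀
    grind [Function.update_apply]
  slot_le a ha := by grind [h.slot_le a ha]
  owner_le s hs := by grind [h.owner_le s hs, Function.update_apply]
  eligible a ha s hs := by grind [h.eligible a ha s]
  price_eq_zero s hs ho := by grind [h.price_eq_zero s hs, Function.update_apply]
  price_le s hs := by grind [h.price_le s hs, Function.update_apply]
  slack a ha s hs s' hs' he' := by
    have := h.slack a ha s
    have := h.holds_iff a ha s₀ hs₀
    grind [Function.update_apply]
  cover hph b hb hUb := by grind [h.cover hph b hb hUb, Function.update_apply]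

end AuctionState

theorem UpperLevels.lower {U g o p : ℕ → ℕ} {ph : ℕ} (hU : UpperLevels m n rk U)
    (h : AuctionState m n rk U ph g o p) (hR : RankTable m n rk) (hno : NoBid m n rk U ph g p) :
    UpperLevels m n rk fun b => if b < n ∧ o b = 0 then U b - 1 else U b where
  levels :=
    { le_two := fun b hb => by
        have := hU.levels.le_two b hb
        split_ifs <;> omega
      out := fun a ha => by
        rw [if_neg (by omega)]
        exact hU.levels.out a ha }
  bound f π hf b hb := by
    have hle := hU.bound f π hf b hb
    split_ifs with ho
    · rcases Nat.eq_zero_or_pos (U b) with hUb | hUb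
      · omega
      · have := h.lt_level_of_uncovered hR hU hno hf hb hUb.ne' ho.2
        omega
    · exact hle

theorem UpperLevels.initial {U : ℕ → ℕ} (hjob : ∀ b < n, U b = 2)
    (hout : ∀ a < m, U (n + a) = 1) : UpperLevels m n rk U where
  levels := ⟨fun b hb => (hjob b hb).le, hout⟩
  bound _ _ hf b hb := hjob b hb ▸ hf.levels.le_two b hb

end Auction

section Ranks

variable {m n : ℕ} {I J : Market m n}

/-- The rows of the rank table as lists: the preference lists of the first instance, followed by
those of the second. -/
def rowList (I J : Market m n) (x : ℕ) : List ℕ :=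
  if h : x < m then (I.list ⟨x, h⟩).map Fin.val
  else if h : x - m < m then (J.list ⟨x - m, h⟩).map Fin.val else []

/-- The rank table of a pair of instances. Ranks of jobs start at `1`, and the outside option of an
agent, which comes last, is ranked in her row for the first instance only: the ranks in the second
row of an agent matter for comparisons between jobs alone. -/
def rankOf (I J : Market m n) (x c : ℕ) : ℕ :=
  if c < n then if c ∈ rowList I J x then (rowList I J x).idxOf c + 1 else 0
  else if c = n + x then n + 1 else 0

theorem idxOf_map_of_injective {α β : Type*} [DecidableEq α] [DecidableEq β] {g : α → β}
    (hg : Function.Injective g) (l : List α) (x : α) : (l.map g).idxOf (g x) = l.idxOf x := by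
  induction l with
  | nil => rfl
  | cons y l ih => simp only [List.map_cons, List.idxOf_cons, ih, beq_eq_decide, hg.eq_iff]

theorem mem_rowList_lt {x c : ℕ} (hc : c ∈ rowList I J x) : c < n := by
  unfold rowList at hc
  split_ifs at hc
  · obtain ⟨b, -, rfl⟩ := List.mem_map.1 hc
    exact b.2
  · obtain ⟨b, -, rfl⟩ := List.mem_map.1 hc
    exact b.2
  · exact absurd hc List.not_mem_nil

theorem nodup_rowList (I J : Market m n) (x : ℕ) : (rowList I J x).Nodup := by
  unfold rowList
  split_ifs
  · exact (I.nodup _).map Fin.val_injective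
  · exact (J.nodup _).map Fin.val_injective
  · exact List.nodup_nil

theorem length_rowList_le (I J : Market m n) (x : ℕ) : (rowList I J x).length ≤ n := by
  have hsub : rowList I J x ⊆ List.range n := fun _ hc => List.mem_range.2 (mem_rowList_lt hc)
  simpa only [List.length_range] using ((nodup_rowList I J x).subperm hsub).length_le

theorem rankOf_of_rowList_eq {K : Market m n} {a : Fin m} {x : ℕ}
    (h : rowList I J x = (K.list a).map Fin.val) (b : Fin n) :
    rankOf I J x b = if K.Edge a b then (K.list a).idxOf b + 1 else 0 := by
  simp only [rankOf, if_pos b.2, h, idxOf_map_of_injective Fin.val_injective,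
    List.mem_map_of_injective Fin.val_injective, Market.Edge]

theorem rankOf_fst (I J : Market m n) (a : Fin m) (b : Fin n) :
    rankOf I J a b = if I.Edge a b then (I.list a).idxOf b + 1 else 0 :=
  rankOf_of_rowList_eq (by simp [rowList]) b

theorem rankOf_snd (I J : Market m n) (a : Fin m) (b : Fin n) :
    rankOf I J (m + a) b = if J.Edge a b then (J.list a).idxOf b + 1 else 0 :=
  rankOf_of_rowList_eq (by simp [rowList]) b

theorem rankOf_fst_ne_zero {a : Fin m} {b : Fin n} : rankOf I J a b ≠ 0 ↔ I.Edge a b := by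
  rw [rankOf_fst]
  split_ifs with h <;> simp [h]

theorem rankOf_le (I J : Market m n) (x : ℕ) {c : ℕ} (hc : c < n) : rankOf I J x c ≤ n := by
  unfold rankOf
  rw [if_pos hc]
  split_ifs with h
  · exact (List.idxOf_lt_length_of_mem h).trans_le (length_rowList_le I J x)
  · exact Nat.zero_le n

theorem rankOf_fst_injOn {a : Fin m} {b c : Fin n} (hb : I.Edge a b)
    (h : rankOf I J a b = rankOf I J a c) : b = c := by
  rw [rankOf_fst, rankOf_fst, if_pos hb] at h
  split_ifs at h
  exact (List.idxOf_inj hb).1 (Nat.succ_injective h)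

theorem rankTable_rankOf (I J : Market m n) : RankTable m n (rankOf I J) where
  ne a ha b hb c hc h hne heq := hne <| congrArg Fin.val <|
    rankOf_fst_injOn (a := ⟨a, ha⟩) (b := ⟨b, hb⟩) (c := ⟨c, hc⟩) (rankOf_fst_ne_zero.1 h) heq
  le a _ b hb := rankOf_le I J a hb
  own a _ := by simp [rankOf]
  other a _ a' _ hne := by simp [rankOf, hne]

theorem aboveEither_iff_rankOf (hE : ∀ a b, I.Edge a b ↔ J.Edge a b) {a : Fin m}
    {b c : Fin n} (hb : I.Edge a b) (hc : I.Edge a c) :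
    I.AboveEither J a c b ↔ rankOf I J a c < rankOf I J a b ∨
      rankOf I J (m + a) c < rankOf I J (m + a) b := by
  have hb' := (hE a b).1 hb
  have hc' := (hE a c).1 hc
  simp only [rankOf_fst, rankOf_snd, Market.AboveEither, Market.Above, hb, hc, hb', hc', if_true,
    true_and, Nat.add_lt_add_iff_right]

theorem usable_job_iff (hE : ∀ a b, I.Edge a b ↔ J.Edge a b) (U : ℕ → ℕ) (a : Fin m)
    (b : Fin n) :
    Usable m n (rankOf I J) U a b ↔ I.Edge a b ∧ ∀ c : Fin n, I.Edge a c → c ≠ b →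
      (I.AboveEither J a c b → U b < U c) ∧ U b ≤ U c + 1 := by
  unfold Usable
  rw [rankOf_fst_ne_zero, ← Fin.forall_iff (p := fun c => JobClause m (rankOf I J) U a b c)]
  refine and_congr_right fun hb => forall_congr' fun c => ?_
  rw [JobClause, rankOf_fst_ne_zero, Fin.val_ne_iff]
  refine forall₂_congr fun hac _ => ?_
  rw [aboveEither_iff_rankOf hE hb hac]
  split_ifs with h
  · simp only [h, true_imp_iff, iff_self_and]
    omega
  · simp only [h, false_imp_iff, true_and]

theorem usable_outside_iff {U : ℕ → ℕ} {a : Fin m} (hU : U (n + a) = 1) :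
    Usable m n (rankOf I J) U a (n + a) ↔ ∀ c : Fin n, I.Edge a c → 2 ≤ U c := by
  have hR := rankTable_rankOf I J
  have hown := hR.own a a.2
  rw [Usable, and_iff_right (by omega),
    ← Fin.forall_iff (p := fun c => JobClause m (rankOf I J) U a (n + a) c)]
  refine forall_congr' fun c => ?_
  have hle := hR.le a a.2 c c.2
  rw [JobClause, if_pos (Or.inl (by omega)), hU, rankOf_fst_ne_zero]
  exact forall_congr' fun _ => ⟨fun h => h (by omega), fun h _ => h⟩

/-- The assignment of jobs that underlies an assignment of slots. -/
def jobAssign (m n : ℕ) (F : ℕ → ℕ) (a : Fin m) : Option (Fin n) :=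
  if h : F a < n then some ⟨F a, h⟩ else none

theorem jobAssign_eq_some {F : ℕ → ℕ} {a : Fin m} {b : Fin n} :
    jobAssign m n F a = some b ↔ F a = b := by
  unfold jobAssign
  split_ifs with h
  · simp only [Option.some.injEq, Fin.ext_iff]
  · simp only [false_iff]
    omega

theorem jobAssign_eq_none {F : ℕ → ℕ} {a : Fin m} : jobAssign m n F a = none ↔ n ≤ F a := by
  simp [jobAssign]

theorem Solution.certificate (hE : ∀ a b, I.Edge a b ↔ J.Edge a b) {F U : ℕ → ℕ}
    (h : Solution m n (rankOf I J) F U) :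
    Certificate I (I.AboveEither J) (jobAssign m n F) fun b => U b := by
  have usable_job : ∀ {a : Fin m} {b : Fin n}, jobAssign m n F a = some b →
      Usable m n (rankOf I J) U a b := fun {a b} hab => jobAssign_eq_some.1 hab ▸ h.usable a a.2
  refine ⟨⟨fun hab => ((usable_job_iff hE U _ _).1 (usable_job hab)).1,
      fun {a a' b} hab hab' => ?_⟩,
    fun b => h.levels.le_two b b.2,
    fun hab hac hcb => (((usable_job_iff hE U _ _).1 (usable_job hab)).2 _ hac hcb).1,
    fun hab hac hcb => (((usable_job_iff hE U _ _).1 (usable_job hab)).2 _ hac hcb).2,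
    fun {a c} ha hac => ?_, fun {b} hb => ?_⟩
  · rw [jobAssign_eq_some] at hab hab'
    exact Fin.ext (h.inj a a.2 a' a'.2 (hab.trans hab'.symm))
  · have husable := h.usable a a.2
    have hown : F a = n + a :=
      (husable.job_or_own (rankTable_rankOf I J) a.2 (h.lt a a.2)).resolve_left
        (jobAssign_eq_none.1 ha).not_gt
    rw [hown] at husable
    exact (usable_outside_iff (h.levels.out a a.2)).1 husable c hac
  · obtain ⟨a, ha, hab⟩ := h.cover b b.2 hb
    exact ⟨⟨a, ha⟩, jobAssign_eq_some.2 hab⟩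

theorem exists_slots_of_isAssignment {f : Fin m → Option (Fin n)} (hf : I.IsAssignment f) :
    ∃ F : ℕ → ℕ, (∀ a : Fin m, F a = (f a).elim (n + a.val) Fin.val) ∧
      ∀ a a' : Fin m, F a = F a' → a = a' := by
  let F : ℕ → ℕ := fun a => if ha : a < m then (f ⟨a, ha⟩).elim (n + a) Fin.val else 0
  have hF : ∀ a : Fin m, F a = (f a).elim (n + a.val) Fin.val := fun a => by simp [F]
  refine ⟨F, hF, fun a a' haa' => ?_⟩
  rw [hF, hF] at haa'
  rcases hfa : f a with _ | b <;> rcases hfa' : f a' with _ | b' <;>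
    simp only [hfa, hfa', Option.elim] at haa'
  · omega
  · omega
  · omega
  · exact hf.inj hfa (Fin.ext haa' ▸ hfa')

theorem Certificate.exists_solution (hE : ∀ a b, I.Edge a b ↔ J.Edge a b)
    {f : Fin m → Option (Fin n)} {π : Fin n → ℕ} (h : Certificate I (I.AboveEither J) f π) :
    ∃ F U, Solution m n (rankOf I J) F U := by
  obtain ⟨F, hF, hinj⟩ := exists_slots_of_isAssignment h.assignment
  let U : ℕ → ℕ := fun s => if hs : s < n then π ⟨s, hs⟩ else 1
  have hU : ∀ b : Fin n, U b = π b := fun b => by simp [U]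
  have hUout : ∀ a, U (n + a) = 1 := fun a => by simp [U]
  have lt_usable : ∀ a : Fin m, F a < n + m ∧ Usable m n (rankOf I J) U a (F a) := fun a => by
    rw [hF]
    rcases hfa : f a with _ | b
    · refine ⟨Nat.add_lt_add_left a.2 n, (usable_outside_iff (hUout a)).2 fun c hc => ?_⟩
      exact hU c ▸ h.two_le hfa hc
    · refine ⟨Nat.lt_add_right m b.2, (usable_job_iff hE U a b).2
        ⟨h.assignment.edge hfa, fun c hc hcb => ?_⟩⟩
      rw [hU, hU]
      exact ⟨h.lt_of_rel hfa hc hcb, h.le_succ hfa hc hcb⟩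
  refine ⟨F, U, ⟨fun b hb => hU ⟨b, hb⟩ ▸ h.le_two _, fun a _ => hUout a⟩,
    fun a ha => (lt_usable ⟨a, ha⟩).1, fun a ha => (lt_usable ⟨a, ha⟩).2,
    fun a ha a' ha' haa' => congrArg Fin.val (hinj ⟨a, ha⟩ ⟨a', ha'⟩ haa'), fun b hb hUb => ?_⟩
  obtain ⟨a, hab⟩ := h.exists_eq_some (b := ⟨b, hb⟩) (hU ⟨b, hb⟩ ▸ hUb)
  exact ⟨a, a.2, by rw [hF, hab, Option.elim]⟩

theorem Market.DifferInOneAgent.exists_isRobustPopular_iff (hIJ : I.DifferInOneAgent J) :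
    (∃ M, I.IsRobustPopular J M) ↔ ∃ F U, Solution m n (rankOf I J) F U := by
  constructor
  · rintro ⟨M, hM⟩
    obtain ⟨f, rfl⟩ := hM.1.1.exists_eq_edgesOf
    obtain ⟨π, hπ⟩ := hIJ.isRobustPopular_edgesOf.1 hM
    exact hπ.exists_solution hIJ.1
  · rintro ⟨F, U, h⟩
    exact ⟨_, hIJ.isRobustPopular_edgesOf.2 ⟨_, h.certificate hIJ.1⟩⟩

end Ranks

section Logic

/-- A bound for the running time of a program on inputs for which every loop makes at most `X`
iterations. -/
noncomputable def Prog.timeBound : Prog → Polynomial ℕ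
  | .skip => 1
  | .write _ i e => (i.cost + e.cost + 1 : ℕ)
  | .seq c d => c.timeBound + d.timeBound
  | .cond e c d => ((e.cost + 1 : ℕ) : Polynomial ℕ) + (c.timeBound + d.timeBound)
  | .loop e c => (Polynomial.X + 1) * (c.timeBound + ((e.cost + 1 : ℕ) : Polynomial ℕ))

/-- The program `c`, started with memory `s`, halts within its time bound for loops with at most `N`
iterations, and the final memory satisfies `Q`. -/
def Runs (N : ℕ) (c : Prog) (s : Store) (Q : Store → Prop) : Prop :=
  ∃ s' t, Exec c s s' t ∧ t ≤ c.timeBound.eval N ∧ Q s'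

/-- The arrays to which a program writes. -/
def Prog.targets : Prog → List ℕ
  | .skip => []
  | .write r _ _ => [r]
  | .seq c d => c.targets ++ d.targets
  | .cond _ c d => c.targets ++ d.targets
  | .loop _ c => c.targets

/-- The memories agree on all arrays outside the list `l`. -/
def Frame (l : List ℕ) (s s' : Store) : Prop := ∀ r ∉ l, s' r = s r

/-- The weakest precondition of a program without loops. -/
def wp (Q : Store → Prop) : Prog → Store → Prop
  | .skip, s => Q s
  | .write r i e, s => Q (s.set r (i.eval s) (e.eval s))
  | .seq c d, s => wp (wp Q d) c s
  | .cond e c d, s => (e.eval s ≠ 0 → wp Q c s) ∧ (e.eval s = 0 → wp Q d s)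
  | .loop _ _, _ => False

/-- The expression that reads cell `0` of an array. -/
def var (r : ℕ) : Expr := .read r (.const 0)

/-- The assignment to cell `0` of an array. -/
def assign (r : ℕ) (e : Expr) : Prog := .write r (.const 0) e

instance (k : ℕ) : OfNat Expr k := ⟨.const k⟩

instance : Add Expr := ⟨.plus⟩

instance : Sub Expr := ⟨.minus⟩

infixr:60 ";; " => Prog.seq

/-- The loop that executes `c` for `i = 0, …, b - 1`. -/
def forLoop (i : ℕ) (b : Expr) (c : Prog) : Prog :=
  assign i 0;; .loop (b - var i) (c;; assign i (var i + 1))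

variable {N : ℕ} {c d : Prog} {e : Expr} {s s' s'' : Store} {Q R : Store → Prop} {l l' : List ℕ}

theorem Store.set_apply (s : Store) (r i v r' i' : ℕ) :
    s.set r i v r' i' = if r' = r ∧ i' = i then v else s r' i' := by
  by_cases hr : r' = r
  · subst hr
    simp [Store.set, Function.update_apply]
  · simp [Store.set, hr]

theorem Store.set_of_ne (s : Store) {r r' : ℕ} (i v : ℕ) (h : r' ≠ r) : s.set r i v r' = s r' :=
  Function.update_of_ne h _ _

@[simp]
theorem Expr.eval_var (s : Store) (r : ℕ) : (var r).eval s = s r 0 := rfl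

@[simp]
theorem Expr.eval_ofNat (s : Store) (k : ℕ) : Expr.eval s (no_index (OfNat.ofNat k)) = k := rfl

@[simp]
theorem Expr.eval_sub (s : Store) (e f : Expr) : (e - f).eval s = e.eval s - f.eval s := rfl

theorem Frame.trans (h : Frame l s s') (h' : Frame l s' s'') : Frame l s s'' :=
  fun r hr => (h' r hr).trans (h r hr)

theorem Frame.mono (h : Frame l s s') (hl : l ⊆ l') : Frame l' s s' :=
  fun r hr => h r fun hr' => hr (hl hr')

theorem Frame.eq_of_mem (h : Frame l s s') (hl : ∀ r ∈ l, r ∉ l') {r : ℕ} (hr : r ∈ l') :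
    s' r = s r :=
  h r fun hr' => hl r hr' hr

theorem Exec.frame {t : ℕ} (h : Exec c s s' t) : Frame c.targets s s' := by
  induction h with
  | skip | loop_false => exact fun _ _ => rfl
  | write r i e s => exact fun r' hr' => s.set_of_ne _ _ fun h => hr' (List.mem_singleton.2 h)
  | seq _ _ ih ih' =>
    exact (ih.mono (List.subset_append_left _ _)).trans (ih'.mono (List.subset_append_right _ _))
  | cond_true _ _ ih => exact ih.mono (List.subset_append_left _ _)
  | cond_false _ _ ih => exact ih.mono (List.subset_append_right _ _)
  | loop_true _ _ _ ih ih' => exact ih.trans ih'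

namespace Runs

theorem mono (h : Runs N c s Q) (hQ : ∀ s', Q s' → R s') : Runs N c s R := by
  obtain ⟨s', t, he, ht, hs'⟩ := h
  exact ⟨s', t, he, ht, hQ s' hs'⟩

theorem frame (h : Runs N c s Q) : Runs N c s fun s' => Frame c.targets s s' ∧ Q s' := by
  obtain ⟨s', t, he, ht, hs'⟩ := h
  exact ⟨s', t, he, ht, he.frame, hs'⟩

theorem skip (h : Q s) : Runs N .skip s Q :=
  ⟨s, 1, .skip s, by simp [Prog.timeBound], h⟩

theorem write {r : ℕ} {i : Expr} (h : Q (s.set r (i.eval s) (e.eval s))) :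
    Runs N (.write r i e) s Q :=
  ⟨_, _, .write r i e s, by simp [Prog.timeBound], h⟩

theorem assign (s : Store) (r : ℕ) (e : Expr) :
    Runs N (assign r e) s fun s' => Frame [r] s s' ∧ s' r 0 = e.eval s :=
  .write ⟨fun _ hr' => s.set_of_ne _ _ (List.ne_of_not_mem_cons hr'),
    (s.set_apply ..).trans (if_pos ⟨rfl, rfl⟩)⟩

theorem seq (h : Runs N c s R) (h' : ∀ s', R s' → Runs N d s' Q) : Runs N (c;; d) s Q := by
  obtain ⟨s₁, t₁, he₁, ht₁, hs₁⟩ := h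
  obtain ⟨s₂, t₂, he₂, ht₂, hs₂⟩ := h' s₁ hs₁
  refine ⟨s₂, t₁ + t₂, .seq he₁ he₂, ?_, hs₂⟩
  rw [Prog.timeBound, Polynomial.eval_add]
  exact Nat.add_le_add ht₁ ht₂

theorem cond (h : e.eval s ≠ 0 → Runs N c s Q) (h' : e.eval s = 0 → Runs N d s Q) :
    Runs N (.cond e c d) s Q := by
  by_cases he : e.eval s = 0
  · obtain ⟨s₁, t, hx, ht, hs₁⟩ := h' he
    refine ⟨s₁, _, .cond_false he hx, ?_, hs₁⟩
    simp only [Prog.timeBound, Polynomial.eval_add, Polynomial.eval_natCast, Nat.cast_id]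
    omega
  · obtain ⟨s₁, t, hx, ht, hs₁⟩ := h he
    refine ⟨s₁, _, .cond_true he hx, ?_, hs₁⟩
    simp only [Prog.timeBound, Polynomial.eval_add, Polynomial.eval_natCast, Nat.cast_id]
    omega

theorem loop (Inv : Store → Prop) (μ : Store → ℕ) (hs : Inv s) (hμ : μ s ≤ N)
    (hstep : ∀ s', Inv s' → e.eval s' ≠ 0 → Runs N c s' fun s'' => Inv s'' ∧ μ s'' < μ s') :
    Runs N (.loop e c) s fun s' => Inv s' ∧ e.eval s' = 0 := by
  let T := c.timeBound.eval N + (e.cost + 1)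
  suffices h : ∀ k s, Inv s → μ s ≤ k →
      ∃ s' t, Exec (.loop e c) s s' t ∧ t ≤ (k + 1) * T ∧ Inv s' ∧ e.eval s' = 0 by
    obtain ⟨s', t, he, ht, hs'⟩ := h N s hs hμ
    exact ⟨s', t, he, by simpa [Prog.timeBound, T] using ht, hs'⟩
  have hT : e.cost + 1 ≤ T := Nat.le_add_left _ _
  intro k
  induction k with
  | zero =>
    intro s hs hμ
    by_cases he : e.eval s = 0
    · exact ⟨s, _, .loop_false he, by omega, hs, he⟩
    · obtain ⟨_, _, _, _, _, hlt⟩ := hstep s hs he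
      omega
  | succ k ih =>
    intro s hs hμ
    by_cases he : e.eval s = 0
    · exact ⟨s, _, .loop_false he, hT.trans (Nat.le_mul_of_pos_left T (by omega)), hs, he⟩
    · obtain ⟨s₁, t₁, hx₁, ht₁, hs₁, hlt⟩ := hstep s hs he
      obtain ⟨s₂, t₂, hx₂, ht₂, hs₂⟩ := ih s₁ hs₁ (by omega)
      refine ⟨s₂, _, .loop_true he hx₁ hx₂, ?_, hs₂⟩
      rw [Nat.succ_mul]
      omega

theorem of_wp (h : wp Q c s) : Runs N c s Q := by
  induction c generalizing s Q with
  | skip => exact .skip h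
  | write r i e => exact .write h
  | seq c d ihc ihd => exact (ihc h).seq fun _ => ihd
  | cond e c d ihc ihd => exact .cond (fun he => ihc (h.1 he)) fun he => ihd (h.2 he)
  | loop => exact h.elim

theorem forLoop {i K : ℕ} {b : Expr} (Inv : ℕ → Store → Prop) (hi : i ∉ c.targets)
    (hb : ∀ s', Frame (i :: c.targets) s s' → b.eval s' = K) (hK : K ≤ N)
    (hInv : ∀ k s' v, Inv k s' → Inv k (s'.set i 0 v)) (h₀ : Inv 0 s)
    (hstep : ∀ k < K, ∀ s', s' i 0 = k → Frame (i :: c.targets) s s' → Inv k s' →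
      Runs N c s' (Inv (k + 1))) :
    Runs N (forLoop i b c) s (Inv K) := by
  have frame_set : ∀ {s' : Store} (v : ℕ), Frame (i :: c.targets) s' (s'.set i 0 v) :=
    fun v r hr => Store.set_of_ne _ _ _ (List.ne_of_not_mem_cons hr)
  have set_self : ∀ (s' : Store) (v : ℕ), s'.set i 0 v i 0 = v := fun s' v => by
    rw [Store.set_apply, if_pos ⟨rfl, rfl⟩]
  refine (write (Q := fun s' => s' i 0 = 0 ∧ Frame (i :: c.targets) s s' ∧ Inv 0 s')
    ⟨set_self s 0, frame_set 0, hInv 0 s 0 h₀⟩).seq fun s₁ ⟨hs₁i, hs₁, h₁⟩ => ?_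
  refine (loop (fun s' => s' i 0 ≤ K ∧ Frame (i :: c.targets) s s' ∧ Inv (s' i 0) s')
    (fun s' => K - s' i 0) ⟨by omega, hs₁, hs₁i.symm ▸ h₁⟩ (by omega)
    fun s' ⟨_, hs', h'⟩ hne => ?_).mono fun s' ⟨⟨hle, hs', h'⟩, he⟩ => ?_
  · have hlt : s' i 0 < K := Nat.lt_of_sub_ne_zero (hb s' hs' ▸ hne)
    refine (hstep _ hlt s' rfl hs' h').frame.seq fun s'' ⟨hs'', h''⟩ => write ?_
    have hi'' : (var i).eval s'' = s' i 0 := congrFun (hs'' i hi) 0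
    simp only [Expr.eval, set_self, hi'']
    exact ⟨⟨hlt, (hs'.trans (hs''.mono (List.subset_cons_self _ _))).trans (frame_set _),
      hInv _ _ _ h''⟩, by omega⟩
  · have : K - s' i 0 = 0 := hb s' hs' ▸ he
    obtain rfl : s' i 0 = K := by omega
    exact h'

end Runs

end Logic

section Rounds

variable {m n : ℕ} {rk : ℕ → ℕ → ℕ}

/-- The data of the auction: a flag for whether it is still running, its phase, the levels, and
assignment and prices as in `AuctionState`. -/
structure Auction where
  running : ℕ
  phase : ℕ
  level : ℕ → ℕ
  held : ℕ → ℕ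
  owner : ℕ → ℕ
  price : ℕ → ℕ

/-- Agent `a` has no slot and may bid for slot `t`. -/
def Auction.IsBid (m n : ℕ) (rk : ℕ → ℕ → ℕ) (A : Auction) (a t : ℕ) : Prop :=
  a < m ∧ t < n + m ∧ A.held a = 0 ∧ Eligible m n rk A.level A.phase a t

/-- One round of the auction: a cheapest bid if its price is not maximal; otherwise lowering the
levels of the unowned jobs, entering the second phase, or stopping. -/
inductive AuctionStep (m n : ℕ) (rk : ℕ → ℕ → ℕ) (A : Auction) : Auction → Prop
  | bid {a t : ℕ} (hbid : A.IsBid m n rk a t) (hprice : A.price t < m + 2)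
      (hmin : ∀ a' t', A.IsBid m n rk a' t' → A.price t ≤ A.price t') :
      AuctionStep m n rk A { A with
        held := fun x => if x = a then t + 1 else if A.owner t = x + 1 then 0 else A.held x
        owner := Function.update A.owner t (a + 1)
        price := Function.update A.price t (A.price t + 1) }
  | lower {held owner price : ℕ → ℕ} (hno : NoBid m n rk A.level A.phase A.held A.price)
      (hfree : ∃ b < n, A.level b ≠ 0 ∧ A.owner b = 0) (hheld : ∀ a < m, held a = 0)
      (howner : ∀ s < n + m, owner s = 0) (hprice : ∀ s < n + m, price s = 0) :
      AuctionStep m n rk A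
        ⟨A.running, 0, fun b => if b < n ∧ A.owner b = 0 then A.level b - 1 else A.level b,
          held, owner, price⟩
  | nextPhase {price : ℕ → ℕ} (hphase : A.phase = 0)
      (hcover : ∀ b < n, A.level b ≠ 0 → A.owner b ≠ 0) (hprice : ∀ s < n + m, price s = 0) :
      AuctionStep m n rk A { A with phase := 1, price := price }
  | halt (hno : NoBid m n rk A.level A.phase A.held A.price) (hphase : A.phase ≠ 0) :
      AuctionStep m n rk A { A with running := 0 }

/-- The invariant of the auction. -/
structure Auction.Invariant (m n : ℕ) (rk : ℕ → ℕ → ℕ) (A : Auction) : Prop where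
  upper : UpperLevels m n rk A.level
  state : AuctionState m n rk A.level A.phase A.held A.owner A.price
  halted : A.running = 0 → A.phase ≠ 0 ∧ NoBid m n rk A.level A.phase A.held A.price

/-- A bound for the sum of the prices. -/
def priceBound (m n : ℕ) : ℕ := (n + m) * (m + 2)

/-- A bound for the number of rounds that remain: levels only fall, at constant levels the phase
only rises, and within a phase the prices only rise. -/
def Auction.progress (m n : ℕ) (A : Auction) : ℕ :=
  A.running + (∑ b ∈ Finset.range n, A.level b) * (2 * (priceBound m n + 1)) +
    (1 - A.phase) * (priceBound m n + 1) +
    (priceBound m n - ∑ s ∈ Finset.range (n + m), A.price s)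

/-- The auction at its start: all jobs have level `2`, and all outside options level `1`. -/
def Auction.initial (m n : ℕ) : Auction where
  running := 1
  phase := 0
  level t := if t < n then 2 else if t < n + m then 1 else 0
  held := 0
  owner := 0
  price := 0

theorem Auction.progress_initial (m n : ℕ) : (Auction.initial m n).progress m n =
    1 + 2 * n * (2 * (priceBound m n + 1)) + (priceBound m n + 1) + priceBound m n := by
  have hlevel : ∑ b ∈ Finset.range n, (if b < n then 2 else if b < n + m then 1 else 0) = n * 2 :=
    (Finset.sum_congr rfl fun b hb => if_pos (Finset.mem_range.1 hb)).trans (by simp)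
  simp [progress, initial, hlevel, mul_comm n 2]

theorem AuctionState.sum_price_le {U g o p : ℕ → ℕ} {ph : ℕ}
    (h : AuctionState m n rk U ph g o p) : ∑ s ∈ Finset.range (n + m), p s ≤ priceBound m n := by
  simpa only [priceBound, Finset.card_range, smul_eq_mul] using
    Finset.sum_le_card_nsmul (Finset.range (n + m)) p (m + 2)
      fun s hs => h.price_le s (Finset.mem_range.1 hs)

namespace Auction.Invariant

variable {A A' : Auction}

theorem initial (m n : ℕ) (rk : ℕ → ℕ → ℕ) : (Auction.initial m n).Invariant m n rk where
  upper := .initial (fun b hb => if_pos hb) fun a ha =>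
    (if_neg (by omega)).trans (if_pos (by omega))
  state := .reset _ (fun _ _ => rfl) (fun _ _ => rfl) fun _ _ => rfl
  halted h := absurd h one_ne_zero

theorem solution (h : A.Invariant m n rk) (hhalted : A.running = 0) (hall : ∀ a < m, A.held a ≠ 0) :
    Solution m n rk (fun a => A.held a - 1) A.level :=
  h.state.solution h.upper.levels (h.halted hhalted).1 hall

theorem not_solution (h : A.Invariant m n rk) (hR : RankTable m n rk) (hhalted : A.running = 0)
    (hfree : ¬ ∀ a < m, A.held a ≠ 0) : ¬ ∃ f π, Solution m n rk f π := by
  push Not at hfree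
  obtain ⟨a, ha, hfree⟩ := hfree
  rintro ⟨f, π, hf⟩
  obtain ⟨hphase, hno⟩ := h.halted hhalted
  exact h.state.not_solution_of_free hR h.upper hno hphase ha hfree f π hf

theorem step (h : A.Invariant m n rk) (hR : RankTable m n rk) (hrun : A.running ≠ 0)
    (hstep : AuctionStep m n rk A A') : A'.Invariant m n rk := by
  cases hstep with
  | bid hbid hprice hmin =>
    obtain ⟨ha, ht, hfree, he⟩ := hbid
    exact ⟨h.upper, h.state.bid ha ht hfree he hprice fun s hs hes => hmin _ s ⟨ha, hs, hfree, hes⟩,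
      fun h₀ => absurd h₀ hrun⟩
  | lower hno _ hheld howner hprice =>
    exact ⟨h.upper.lower h.state hR hno, .reset _ hheld howner hprice, fun h₀ => absurd h₀ hrun⟩
  | nextPhase _ hcover hprice =>
    exact ⟨h.upper, h.state.next_phase hcover hprice, fun h₀ => absurd h₀ hrun⟩
  | halt hno hphase => exact ⟨h.upper, h.state, fun _ => ⟨hphase, hno⟩⟩

theorem progress_lt (h' : A'.Invariant m n rk) (hrun : A.running ≠ 0)
    (hstep : AuctionStep m n rk A A') : A'.progress m n < A.progress m n := by
  have hsum := h'.state.sum_price_le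
  unfold progress
  cases hstep with
  | @bid a t hbid hprice hmin =>
    have hlt : ∑ s ∈ Finset.range (n + m), A.price s <
        ∑ s ∈ Finset.range (n + m), Function.update A.price t (A.price t + 1) s :=
      Finset.sum_lt_sum (fun s _ => by grind [Function.update_apply])
        ⟨t, Finset.mem_range.2 hbid.2.1, by simp⟩
    dsimp only at *
    omega
  | lower hno hfree hheld howner hprice =>
    obtain ⟨b, hb, hlevel, howned⟩ := hfree
    have hlt : ∑ b ∈ Finset.range n,
          (if b < n ∧ A.owner b = 0 then A.level b - 1 else A.level b) <
        ∑ b ∈ Finset.range n, A.level b := by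
      refine Finset.sum_lt_sum (fun b _ => by grind) ⟨b, Finset.mem_range.2 hb, ?_⟩
      rw [if_pos ⟨hb, howned⟩]
      omega
    have := Nat.mul_le_mul_right (2 * (priceBound m n + 1)) (Nat.succ_le_of_lt hlt)
    rw [Nat.succ_mul] at this
    dsimp only at *
    omega
  | nextPhase hphase =>
    simp only [hphase]
    omega
  | halt =>
    dsimp only
    omega

end Auction.Invariant

end Rounds

section Search

/-- The arrays that the algorithm uses. By convention `input` and `held` are the arrays `0` and `1`;
the content of the arrays `running`, …, `offset` is in cell `0`. -/
inductive Reg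
  | input | held | rank | rowStart | level | price | owner
  | running | phase | agent | slot | job | flag | best | bestAgent | bestSlot | changed | index
  | row | position | length | offset

instance : Coe Reg ℕ := ⟨Reg.ctorIdx⟩

open Reg

variable {m n N : ℕ} {rk : ℕ → ℕ → ℕ} {s s' : Store} {l : List ℕ}

/-- The number of agents. -/
def agents : Expr := .read input 0

/-- The number of jobs. -/
def jobs : Expr := .read input 1

/-- The number of slots. -/
def slots : Expr := jobs + agents

/-- The entry of the rank table in row `x` and column `c`. -/
def rankAt (x c : Expr) : Expr := .read rank (.read rowStart x + c)

/-- The memory contains the numbers of agents and jobs and the rank table. -/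
structure Tables (m n : ℕ) (rk : ℕ → ℕ → ℕ) (s : Store) : Prop where
  agents_eq : s input 0 = m
  jobs_eq : s input 1 = n
  rank_eq : ∀ x < m + m, ∀ c < n + m, s rank (s rowStart x + c) = rk x c

theorem Tables.frame (h : Tables m n rk s) (hf : Frame l s s')
    (hl : ∀ r ∈ l, r ∉ ([input, rank, rowStart] : List ℕ)) : Tables m n rk s' := by
  have hi := hf.eq_of_mem hl (r := input) (by decide)
  exact ⟨hi ▸ h.agents_eq, hi ▸ h.jobs_eq, hf.eq_of_mem hl (r := rank) (by decide) ▸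
    hf.eq_of_mem hl (r := rowStart) (by decide) ▸ h.rank_eq⟩

theorem Tables.eval_slots (h : Tables m n rk s) : slots.eval s = n + m :=
  congrArg₂ (· + ·) h.jobs_eq h.agents_eq

theorem Tables.eval_rankAt (h : Tables m n rk s) {x c : Expr} {i j : ℕ} (hx : x.eval s = i)
    (hc : c.eval s = j) (hi : i < m + m) (hj : j < n + m) : (rankAt x c).eval s = rk i j := by
  subst hx hc
  exact h.rank_eq _ hi _ hj

/-- The state of the auction that is stored in the memory. Cell `0` of array `held` is reserved for
the verdict. -/
def auctionOf (s : Store) : Auction where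
  running := s running 0
  phase := s phase 0
  level := s level
  held a := s held (a + 1)
  owner := s owner
  price := s price

theorem auctionOf_eq_of_frame (hf : Frame l s s')
    (hl : ∀ r ∈ l, r ∉ ([held, level, price, owner, running, phase] : List ℕ)) :
    auctionOf s' = auctionOf s := by
  have heq : ∀ r ∈ ([held, level, price, owner, running, phase] : List ℕ), s' r = s r :=
    fun _ => hf.eq_of_mem hl
  simp only [auctionOf, heq held (by decide), heq level (by decide), heq price (by decide),
    heq owner (by decide), heq running (by decide), heq phase (by decide)]

/-- Clears the flag if the current job does not allow the current agent to hold the current slot. -/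
def clauseProg : Prog :=
  .cond (rankAt (var agent) (var job))
    (.cond (var job - var slot + (var slot - var job))
      (.cond (rankAt (var agent) (var slot) - rankAt (var agent) (var job) +
          (rankAt (agents + var agent) (var slot) - rankAt (agents + var agent) (var job)))
        (.cond (.read level (var job) - .read level (var slot)) .skip (assign flag 0))
        (.cond (.read level (var slot) - (.read level (var job) + 1)) (assign flag 0) .skip))
      .skip)
    .skip

theorem runs_clauseProg (h : Tables m n rk s) {a t b : ℕ} (ha : s agent 0 = a)
    (ht : s slot 0 = t) (hb : s job 0 = b) (ham : a < m) (htn : t < n + m) (hbn : b < n) :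
    Runs N clauseProg s fun s' => s' flag 0 ≠ 0 ↔
      s flag 0 ≠ 0 ∧ JobClause m rk (s level) a t b := by
  have hsum : (agents + var agent).eval s = m + a := congrArg₂ (· + ·) h.agents_eq ha
  have h₁ := h.eval_rankAt (x := var agent) (c := var slot) ha ht (by omega) htn
  have h₂ := h.eval_rankAt (x := var agent) (c := var job) ha hb (by omega) (by omega)
  have h₃ := h.eval_rankAt (c := var slot) hsum ht (by omega) htn
  have h₄ := h.eval_rankAt (c := var job) hsum hb (by omega) (by omega)
  have hrank : rk a t - rk a b + (rk (m + a) t - rk (m + a) b) ≠ 0 ↔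
      rk a b < rk a t ∨ rk (m + a) b < rk (m + a) t := by omega
  have hne : b - t + (t - b) ≠ 0 ↔ b ≠ t := by omega
  refine .of_wp ?_
  simp only [clauseProg, wp, assign, JobClause, Expr.eval, Expr.eval_sub, Expr.eval_var,
    h₁, h₂, h₃, h₄, ht, hb, hne, Store.set_apply]
  simp only [hrank]
  grind

/-- Sets the flag if the current agent has no slot, is adjacent to the current slot, and the current
slot is for sale. -/
def saleTestProg : Prog :=
  assign flag (rankAt (var agent) (var slot));;
  .cond (.read held (var agent + 1)) (assign flag 0) .skip;;
  .cond (var phase) .skip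
    (.cond (jobs - var slot) (.cond (.read level (var slot)) .skip (assign flag 0))
      (assign flag 0))

theorem runs_saleTestProg (h : Tables m n rk s) {a t : ℕ} (ha : s agent 0 = a)
    (ht : s slot 0 = t) (ham : a < m) (htn : t < n + m) :
    Runs N saleTestProg s fun s' => s' flag 0 ≠ 0 ↔
      s held (a + 1) = 0 ∧ (s phase 0 ≠ 0 ∨ t < n ∧ s level t ≠ 0) ∧ rk a t ≠ 0 := by
  have hrank := h.eval_rankAt (x := var agent) (c := var slot) ha ht (by omega) htn
  refine .of_wp ?_
  simp +decide only [saleTestProg, jobs, wp, assign, Expr.eval, Expr.eval_sub, Expr.eval_var,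
    Store.set_apply, hrank, ha, ht, h.jobs_eq, reduceIte, false_and]
  grind

/-- Sets the flag if the current agent may bid for the current slot. -/
def bidTestProg : Prog := saleTestProg;; forLoop job jobs clauseProg

theorem runs_bidTestProg (h : Tables m n rk s) {a t : ℕ} (ha : s agent 0 = a)
    (ht : s slot 0 = t) (ham : a < m) (htn : t < n + m) (hN : n ≤ N) :
    Runs N bidTestProg s fun s' => s' flag 0 ≠ 0 ↔ (auctionOf s).IsBid m n rk a t := by
  refine (runs_saleTestProg h ha ht ham htn).frame.seq fun s₁ ⟨hs₁, hflag⟩ => ?_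
  have frame : ∀ {s'}, Frame (job :: clauseProg.targets) s₁ s' → Frame bidTestProg.targets s s' :=
    fun hs' => (hs₁.mono (by decide)).trans (hs'.mono (by decide))
  refine Runs.mono (Runs.forLoop (K := n) (fun k s' => s' flag 0 ≠ 0 ↔
    s₁ flag 0 ≠ 0 ∧ ∀ b < k, JobClause m rk (s level) a t b) (by decide)
    (fun s' hs' => (h.frame (frame hs') (by decide)).jobs_eq) hN (fun _ _ _ h => h) (by simp)
    fun b hb s' hs'b hs' hInv => ?_) fun s' hs' => ?_
  · have hs := frame hs'
    have hlevel : s' level = s level := hs level (by decide)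
    have hagent : s' agent 0 = a := hs agent (by decide) ▸ ha
    have hslot : s' slot 0 = t := hs slot (by decide) ▸ ht
    refine (runs_clauseProg (h.frame hs (by decide)) hagent hslot hs'b ham htn hb).mono
      fun s'' hs'' => ?_
    rw [hs'', hInv, hlevel, Nat.forall_lt_succ_right, and_assoc]
  · rw [hs', hflag, Auction.IsBid, Eligible, Usable]
    simp only [ham, htn, true_and, and_assoc, auctionOf]

/-- Makes the current bid the best one if the flag is set and the bid is cheaper than the best
one. -/
def compareProg : Prog :=
  .cond (var flag)
    (.cond (var best - .read price (var slot))
      (assign best (.read price (var slot));;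
        assign bestAgent (var agent);;
        assign bestSlot (var slot))
      .skip)
    .skip

/-- The pair `(a, t)` is a cheapest one of the bids in `C` and has price `p`, unless `p ≥ m + 2`, in
which case no bid in `C` is cheaper than `p`. -/
structure BestBid (m n : ℕ) (rk : ℕ → ℕ → ℕ) (A : Auction) (C : ℕ → ℕ → Prop)
    (p a t : ℕ) : Prop where
  le_price : ∀ a' t', C a' t' → A.IsBid m n rk a' t' → p ≤ A.price t'
  isBid : p < m + 2 → A.IsBid m n rk a t
  price_eq : p < m + 2 → A.price t = p

theorem BestBid.mono {A : Auction} {C D : ℕ → ℕ → Prop} {p a t : ℕ} (h : BestBid m n rk A C p a t)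
    (hD : ∀ a' t', D a' t' → A.IsBid m n rk a' t' → C a' t') : BestBid m n rk A D p a t :=
  ⟨fun a' t' hC hB => h.le_price a' t' (hD a' t' hC hB) hB, h.isBid, h.price_eq⟩

theorem runs_compareProg {A : Auction} {C : ℕ → ℕ → Prop} {a t : ℕ}
    (h : BestBid m n rk A C (s best 0) (s bestAgent 0) (s bestSlot 0)) (hprice : s price = A.price)
    (ha : s agent 0 = a) (ht : s slot 0 = t) (hflag : s flag 0 ≠ 0 ↔ A.IsBid m n rk a t) :
    Runs N compareProg s fun s' => BestBid m n rk A (fun a' t' => C a' t' ∨ a' = a ∧ t' = t)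
      (s' best 0) (s' bestAgent 0) (s' bestSlot 0) := by
  refine .of_wp ?_
  simp +decide only [compareProg, wp, assign, Expr.eval, Expr.eval_sub, Expr.eval_var,
    Store.set_apply, ha, ht, hprice, reduceIte]
  obtain ⟨hle, hbid, heq⟩ := h
  refine ⟨fun hf => ⟨fun hlt => ⟨?_, fun _ => hflag.1 hf, fun _ => rfl⟩,
    fun hge => ⟨?_, hbid, heq⟩⟩, fun hf => ⟨?_, hbid, heq⟩⟩ <;>
  · rintro a' t' (hC | ⟨rfl, rfl⟩) hB
    · have := hle a' t' hC hB
      omega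
    · first | omega | exact absurd hB (hflag.not.1 (not_not.2 hf))

/-- Searches for a bid of the current agent that is cheaper than the best one. -/
def searchSlotsProg : Prog := forLoop slot slots (bidTestProg;; compareProg)

theorem runs_searchSlotsProg {A : Auction} {C : ℕ → ℕ → Prop} {a : ℕ} (h : Tables m n rk s)
    (hA : auctionOf s = A) (hbest : BestBid m n rk A C (s best 0) (s bestAgent 0) (s bestSlot 0))
    (ha : s agent 0 = a) (ham : a < m) (hN : n + m ≤ N) :
    Runs N searchSlotsProg s fun s' => BestBid m n rk A (fun a' t' => C a' t' ∨ a' = a)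
      (s' best 0) (s' bestAgent 0) (s' bestSlot 0) := by
  refine Runs.mono (Runs.forLoop (K := n + m) (fun k s' =>
    BestBid m n rk A (fun a' t' => C a' t' ∨ a' = a ∧ t' < k)
      (s' best 0) (s' bestAgent 0) (s' bestSlot 0)) (by decide)
    (fun s' hs' => (h.frame hs' (by decide)).eval_slots) hN (fun _ _ _ h => h)
    (hbest.mono (by simp +contextual)) fun t ht s' hs't hs' hInv => ?_) fun s' hs' => ?_
  · refine (runs_bidTestProg (h.frame hs' (by decide)) (hs' agent (by decide) ▸ ha) hs't ham ht
      (by omega)).frame.seq fun s₁ ⟨hs₁, hflag⟩ => ?_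
    have hs₁' := hs'.trans (hs₁.mono (by decide))
    rw [auctionOf_eq_of_frame hs' (by decide), hA] at hflag
    have hprice : s₁ price = A.price := hA ▸ hs₁' price (by decide)
    have hbest₁ := hInv
    rw [← hs₁ best (by decide), ← hs₁ bestAgent (by decide), ← hs₁ bestSlot (by decide)] at hbest₁
    refine (runs_compareProg hbest₁ hprice (hs₁' agent (by decide) ▸ ha)
      (hs₁ slot (by decide) ▸ hs't) hflag).mono fun s'' hs'' => hs''.mono fun a' t' hC _ => ?_
    rwa [or_assoc, ← and_or_left, ← Nat.lt_succ_iff_lt_or_eq]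
  · exact hs'.mono fun a' t' hC hB => hC.imp_right fun ha' => ⟨ha', hB.2.1⟩

/-- Searches for a cheapest bid. -/
def searchProg : Prog :=
  assign best (agents + 2);;
  forLoop agent agents searchSlotsProg

theorem runs_searchProg (h : Tables m n rk s) (hN : n + m ≤ N) :
    Runs N searchProg s fun s' => BestBid m n rk (auctionOf s) (fun _ _ => True)
      (s' best 0) (s' bestAgent 0) (s' bestSlot 0) := by
  refine (Runs.assign s best (agents + 2)).seq fun s₁ ⟨hs₁, hbest⟩ => ?_
  replace hbest : s₁ best 0 = m + 2 := hbest.trans (congrArg (· + 2) h.agents_eq)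
  refine Runs.mono (Runs.forLoop (K := m) (fun k s' =>
    BestBid m n rk (auctionOf s) (fun a' _ => a' < k)
      (s' best 0) (s' bestAgent 0) (s' bestSlot 0)) (by decide)
    (fun s' hs' => ((h.frame hs₁ (by decide)).frame hs' (by decide)).agents_eq) (by omega)
    (fun _ _ _ h => h) ⟨by simp, by omega, by omega⟩ fun a ha s' hs'a hs' hInv => ?_)
      fun s' hs' => ?_
  · refine (runs_searchSlotsProg ((h.frame hs₁ (by decide)).frame hs' (by decide)) ?_ hInv hs'a ha
      hN).mono fun s'' hs'' => hs''.mono fun a' t' hC _ => Nat.lt_succ_iff_lt_or_eq.1 hC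
    rw [auctionOf_eq_of_frame hs' (by decide), auctionOf_eq_of_frame hs₁ (by decide)]
  · exact hs'.mono fun a' t' _ hB => hB.1

end Search

section RoundProgram

open Reg

variable {m n N : ℕ} {rk : ℕ → ℕ → ℕ} {s s' : Store}

/-- The best bid is made: the current owner of its slot loses the slot to the bidder, and the price
goes up by one. -/
def bidProg : Prog :=
  .write held (.read owner (var bestSlot)) 0;;
  .write held (var bestAgent + 1) (var bestSlot + 1);;
  .write owner (var bestSlot) (var bestAgent + 1);;
  .write price (var bestSlot) (.read price (var bestSlot) + 1)

theorem runs_bidProg {a t : ℕ} (ha : s bestAgent 0 = a) (ht : s bestSlot 0 = t) :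
    Runs N bidProg s fun s' => auctionOf s' = { auctionOf s with
      held := fun x =>
        if x = a then t + 1 else if (auctionOf s).owner t = x + 1 then 0 else (auctionOf s).held x
      owner := Function.update (auctionOf s).owner t (a + 1)
      price := Function.update (auctionOf s).price t ((auctionOf s).price t + 1) } := by
  refine .of_wp ?_
  simp +decide only [bidProg, wp, Expr.eval, Expr.eval_var, Store.set_apply, ha, ht,
    auctionOf, Auction.mk.injEq, funext_iff, Function.update_apply, true_and]
  grind

/-- Sets `b` cells of array `r` to zero, beginning with cell `i`. -/
def clearProg (r i : ℕ) (b : Expr) : Prog := forLoop index b (.write r (var index + .const i) 0)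

theorem runs_clearProg {r i K : ℕ} {b : Expr} (hr : (index : ℕ) ≠ r)
    (hb : ∀ s', Frame [index, r] s s' → b.eval s' = K) (hK : K ≤ N) :
    Runs N (clearProg r i b) s fun s' => ∀ k < K, s' r (k + i) = 0 := by
  refine Runs.forLoop (fun k s' => ∀ j < k, s' r (j + i) = 0) (hr ∘ List.mem_singleton.1) hb hK
    (fun k s' v h => ?_) (by omega) fun k _ s' hs'k _ hInv => .write fun j hj => ?_
  · rwa [Store.set_of_ne _ _ _ hr.symm]
  · simp only [Store.set_apply, Expr.eval_var, Expr.eval, hs'k, true_and]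
    grind

/-- Lowers the levels of the unowned jobs and records whether any level has changed. -/
def lowerProg : Prog :=
  assign changed 0;;
  forLoop index jobs
    (.cond (.read owner (var index)) .skip
      (assign changed (var changed + .read level (var index));;
        .write level (var index) (.read level (var index) - 1)))

theorem runs_lowerProg (h : Tables m n rk s) (hN : n ≤ N) :
    Runs N lowerProg s fun s' =>
      s' level = (fun b => if b < n ∧ s owner b = 0 then s level b - 1 else s level b) ∧
        (s' changed 0 ≠ 0 ↔ ∃ b < n, s level b ≠ 0 ∧ s owner b = 0) := by
  refine (Runs.assign s changed 0).seq fun s₁ ⟨hs₁, hchanged⟩ => ?_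
  refine Runs.forLoop (K := n) (fun k s' =>
      s' level = (fun b => if b < k ∧ s owner b = 0 then s level b - 1 else s level b) ∧
        (s' changed 0 ≠ 0 ↔ ∃ b < k, s level b ≠ 0 ∧ s owner b = 0)) (by decide)
    (fun s' hs' => ((h.frame hs₁ (by decide)).frame hs' (by decide)).jobs_eq) hN
    (fun _ _ _ h => h) ⟨?_, by simp [hchanged]⟩ fun b _ s' hs'b hs' ⟨hlevel, hchanged⟩ => .of_wp ?_
  · simpa using hs₁ level (by decide)
  · have howner : s' owner = s owner := (hs' owner (by decide)).trans (hs₁ owner (by decide))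
    simp +decide only [wp, assign, Expr.eval, Expr.eval_sub, Expr.eval_var,
      Store.set_apply, howner, hs'b, hlevel, Nat.exists_lt_succ_right, ← hchanged, lt_irrefl,
      false_and, funext_iff, reduceIte]
    grind

/-- Starts the auction anew. -/
def resetProg : Prog :=
  clearProg held 1 agents;; clearProg owner 0 slots;; clearProg price 0 slots;; assign phase 0

theorem runs_resetProg (h : Tables m n rk s) (hN : n + m ≤ N) :
    Runs N resetProg s fun s' => (∀ a < m, s' held (a + 1) = 0) ∧ (∀ t < n + m, s' owner t = 0) ∧
      (∀ t < n + m, s' price t = 0) ∧ s' phase 0 = 0 := by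
  refine (runs_clearProg (b := agents) (by decide)
    (fun s' hs' => (h.frame hs' (by decide)).agents_eq) (by omega)).frame.seq
      fun s₁ ⟨hs₁, hheld⟩ => ?_
  have h₁ := h.frame hs₁ (by decide)
  refine (runs_clearProg (by decide) (fun s' hs' => (h₁.frame hs' (by decide)).eval_slots)
    hN).frame.seq fun s₂ ⟨hs₂, howner⟩ => ?_
  have h₂ := h₁.frame hs₂ (by decide)
  refine (runs_clearProg (by decide) (fun s' hs' => (h₂.frame hs' (by decide)).eval_slots)
    hN).frame.seq fun s₃ ⟨hs₃, hprice⟩ => .of_wp ?_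
  rw [← hs₂ held (by decide), ← hs₃ held (by decide)] at hheld
  rw [← hs₃ owner (by decide)] at howner
  simp +decide only [wp, assign, Store.set_apply]
  exact ⟨hheld, howner, hprice, rfl⟩

/-- Stops in the second phase, and enters it otherwise. -/
def advanceProg : Prog :=
  .cond (var phase) (assign running 0) (clearProg price 0 slots;; assign phase 1)

theorem runs_advanceProg (h : Tables m n rk s) (hN : n + m ≤ N)
    (hno : NoBid m n rk (auctionOf s).level (auctionOf s).phase (auctionOf s).held
      (auctionOf s).price)
    (hcover : ∀ b < n, (auctionOf s).level b ≠ 0 → (auctionOf s).owner b ≠ 0) :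
    Runs N advanceProg s fun s' => AuctionStep m n rk (auctionOf s) (auctionOf s') := by
  refine .cond (fun hphase => .write ?_) fun hphase => ?_
  · have hA : auctionOf (s.set running 0 0) = { auctionOf s with running := 0 } := by
      simp +decide only [auctionOf, Store.set_apply, Store.set_of_ne, false_and, reduceIte]
    exact hA ▸ .halt hno hphase
  · refine (runs_clearProg (b := slots) (by decide)
      (fun s' hs' => (h.frame hs' (by decide)).eval_slots) hN).frame.seq
        fun s₁ ⟨hs₁, hprice⟩ => .write ?_
    have hA : auctionOf (s₁.set phase 0 1) =
        { auctionOf s with phase := 1, price := s₁ price } := by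
      simp +decide only [auctionOf, Store.set_apply, Store.set_of_ne, false_and, reduceIte,
        hs₁ running (by decide), hs₁ held (by decide), hs₁ owner (by decide), hs₁ level (by decide)]
    exact hA ▸ .nextPhase hphase hcover hprice

/-- Lowers the levels of the unowned jobs of positive level and starts the auction anew, or advances
it if there are none. -/
def stallProg : Prog := lowerProg;; .cond (var changed) resetProg advanceProg

theorem runs_stallProg (h : Tables m n rk s) (hN : n + m ≤ N)
    (hno : NoBid m n rk (auctionOf s).level (auctionOf s).phase (auctionOf s).held
      (auctionOf s).price) :
    Runs N stallProg s fun s' => AuctionStep m n rk (auctionOf s) (auctionOf s') := by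
  refine (runs_lowerProg h (by omega)).frame.seq fun s₁ ⟨hs₁, hlevel, hchanged⟩ => ?_
  have h₁ := h.frame hs₁ (by decide)
  refine .cond (fun hne => ?_) fun heq => ?_
  · refine (runs_resetProg h₁ hN).frame.mono fun s' ⟨hs', hheld, howner, hprice, hphase⟩ => ?_
    have hA : auctionOf s' = ⟨s running 0, 0, s₁ level, fun a => s' held (a + 1), s' owner,
        s' price⟩ := by
      simp only [auctionOf, hphase, hs' running (by decide), hs₁ running (by decide),
        hs' level (by decide)]
    rw [hA, hlevel]
    exact .lower hno (hchanged.1 hne) hheld howner hprice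
  · have hcover : ∀ b < n, s level b ≠ 0 → s owner b ≠ 0 := fun b hb hlev hfree =>
      hchanged.2 ⟨b, hb, hlev, hfree⟩ heq
    have hlevel' : s₁ level = s level := hlevel.trans (funext fun b => by grind)
    have hA : auctionOf s₁ = auctionOf s := by
      simp only [auctionOf, hlevel', hs₁ phase (by decide), hs₁ running (by decide),
        hs₁ held (by decide), hs₁ owner (by decide), hs₁ price (by decide)]
    have hadvance := runs_advanceProg h₁ hN (hA ▸ hno) (hA ▸ hcover)
    rwa [hA] at hadvance

/-- One round of the auction. -/
def roundProg : Prog := searchProg;; .cond (agents + 2 - var best) bidProg stallProg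

theorem runs_roundProg (h : Tables m n rk s) (hN : n + m ≤ N) :
    Runs N roundProg s fun s' =>
      Tables m n rk s' ∧ AuctionStep m n rk (auctionOf s) (auctionOf s') := by
  refine Runs.mono (Runs.frame (Q := fun s' => AuctionStep m n rk (auctionOf s) (auctionOf s')) ?_)
    fun s' hs' => hs'.imp_left (h.frame · (by decide))
  refine (runs_searchProg h hN).frame.seq fun s₁ ⟨hs₁, hbest⟩ => ?_
  have hA := auctionOf_eq_of_frame hs₁ (by decide)
  have h₁ := h.frame hs₁ (by decide)
  have heval : (agents + 2 - var best : Expr).eval s₁ = m + 2 - s₁ best 0 := by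
    simp only [Expr.eval_sub, Expr.eval_var, agents, Expr.eval,
      h₁.agents_eq]
  rw [← hA] at hbest ⊢
  refine .cond (fun hne => ?_) fun heq => ?_
  · have hlt : s₁ best 0 < m + 2 := by omega
    refine (runs_bidProg rfl rfl).mono fun s' hs' => ?_
    rw [hs']
    have hprice := hbest.price_eq hlt
    exact .bid (hbest.isBid hlt) (hprice ▸ hlt)
      fun a t hat => hprice ▸ hbest.le_price a t trivial hat
  · refine runs_stallProg h₁ hN fun a ha hfree t ht he => ?_
    have := hbest.le_price a t trivial ⟨ha, ht, hfree, he⟩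
    exact (by omega : m + 2 ≤ s₁ best 0).trans this

/-- Rounds of the auction until it stops. -/
def auctionProg : Prog := .loop (var running) roundProg

theorem runs_auctionProg (h : Tables m n rk s) (hR : RankTable m n rk)
    (hA : (auctionOf s).Invariant m n rk) (hN : n + m ≤ N) (hP : (auctionOf s).progress m n ≤ N) :
    Runs N auctionProg s fun s' =>
      Tables m n rk s' ∧ (auctionOf s').Invariant m n rk ∧ (auctionOf s').running = 0 := by
  refine (Runs.loop (fun s' => Tables m n rk s' ∧ (auctionOf s').Invariant m n rk)
    (fun s' => (auctionOf s').progress m n) ⟨h, hA⟩ hP fun s' ⟨h', hA'⟩ hrun => ?_).mono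
    fun s' ⟨⟨h', hA'⟩, hrun⟩ => ⟨h', hA', hrun⟩
  refine (runs_roundProg h' hN).mono fun s'' ⟨h'', hstep⟩ => ?_
  have hA'' := hA'.step hR hrun hstep
  exact ⟨⟨h'', hA''⟩, hA''.progress_lt hrun hstep⟩

/-- Writes the verdict: whether all agents have got a slot. -/
def verdictProg : Prog :=
  .write held 0 1;;
  forLoop index agents (.cond (.read held (var index + 1)) .skip (.write held 0 0))

theorem runs_verdictProg (h : Tables m n rk s) (hN : m ≤ N) :
    Runs N verdictProg s fun s' => (∀ a, s' held (a + 1) = s held (a + 1)) ∧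
      (s' held 0 = 1 ∧ (∀ a < m, s held (a + 1) ≠ 0) ∨
        s' held 0 = 0 ∧ ¬ ∀ a < m, s held (a + 1) ≠ 0) := by
  refine (Runs.write (Q := fun s' => Frame [held] s s' ∧ (∀ a, s' held (a + 1) = s held (a + 1)) ∧
    s' held 0 = 1) ⟨fun r hr => s.set_of_ne _ _ (List.ne_of_not_mem_cons hr), ?_⟩).seq
      fun s₁ ⟨hs₁, hheld₁, hverdict₁⟩ => ?_
  · simp [Store.set_apply]
  refine Runs.forLoop (K := m) (fun k s' => (∀ a, s' held (a + 1) = s held (a + 1)) ∧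
      (s' held 0 = 1 ∧ (∀ a < k, s held (a + 1) ≠ 0) ∨
        s' held 0 = 0 ∧ ¬ ∀ a < k, s held (a + 1) ≠ 0)) (by decide)
    (fun s' hs' => ((h.frame hs₁ (by decide)).frame hs' (by decide)).agents_eq) hN
    (fun _ _ _ h => h) ⟨hheld₁, by simpa using hverdict₁⟩
    fun a _ s' hs'a _ ⟨hheld, _⟩ => .of_wp ?_
  simp +decide only [wp, Expr.eval, Expr.eval_var, Store.set_apply, hs'a, hheld,
    Nat.forall_lt_succ_right, reduceIte]
  grind

end RoundProgram

section Input

open Reg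

variable {m n N : ℕ} {I J : Market m n} {s : Store}

/-- The code of the first `k` lists, each preceded by its length. -/
def rowCode (L : ℕ → List ℕ) (k : ℕ) : List ℕ :=
  (List.range k).flatMap fun x => (L x).length :: L x

theorem rowCode_succ (L : ℕ → List ℕ) (k : ℕ) :
    rowCode L (k + 1) = rowCode L k ++ ((L k).length :: L k) := by
  simp [rowCode, List.range_succ]

theorem exists_rowCode_eq_append (L : ℕ → List ℕ) {k l : ℕ} (h : k < l) :
    ∃ R, rowCode L l = rowCode L k ++ ((L k).length :: (L k ++ R)) := by
  obtain ⟨j, rfl⟩ := Nat.exists_eq_add_of_le (Nat.succ_le_of_lt h)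
  refine ⟨(List.range j).flatMap fun x => (L (k + 1 + x)).length :: L (k + 1 + x), ?_⟩
  rw [← List.cons_append, ← List.append_assoc, ← rowCode_succ, rowCode, List.range_add,
    List.flatMap_append, List.flatMap_map, rowCode]

theorem Market.code_eq_flatMap (I : Market m n) :
    I.code = (List.range m).flatMap fun x =>
      if h : x < m then (I.list ⟨x, h⟩).length :: (I.list ⟨x, h⟩).map Fin.val else [] := by
  rw [Market.code, ← List.map_coe_finRange_eq_range, List.flatMap_map]
  simp

theorem inputWord_eq (I J : Market m n) :
    inputWord I J = m :: n :: rowCode (rowList I J) (m + m) := by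
  rw [inputWord, rowCode, I.code_eq_flatMap, J.code_eq_flatMap, List.range_add,
    List.flatMap_append, List.flatMap_map]
  congr 3 <;> refine List.flatMap_congr fun x hx => ?_ <;> simp [rowList, List.mem_range.1 hx]

theorem inputStore_input (w : List ℕ) (i : ℕ) : inputStore w input i = w.getD i 0 := rfl

theorem inputStore_of_ne (w : List ℕ) {r : ℕ} (hr : r ≠ input) : inputStore w r = 0 :=
  funext fun _ => if_neg hr

/-- The position of row `k` in the input word. -/
def rowPos (I J : Market m n) (k : ℕ) : ℕ := (rowCode (rowList I J) k).length + 2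

theorem rowPos_succ (I J : Market m n) (k : ℕ) :
    rowPos I J (k + 1) = rowPos I J k + 1 + (rowList I J k).length := by
  simp only [rowPos, rowCode_succ, List.length_append, List.length_cons]
  omega

theorem inputStore_rowPos (I J : Market m n) {k : ℕ} (hk : k < m + m) :
    inputStore (inputWord I J) input (rowPos I J k) = (rowList I J k).length := by
  obtain ⟨R, hR⟩ := exists_rowCode_eq_append (rowList I J) hk
  rw [inputStore_input, inputWord_eq, hR, rowPos]
  simp

theorem inputStore_rowPos_add (I J : Market m n) {k i : ℕ} (hk : k < m + m)
    (hi : i < (rowList I J k).length) :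
    inputStore (inputWord I J) input (rowPos I J k + 1 + i) = (rowList I J k)[i] := by
  obtain ⟨R, hR⟩ := exists_rowCode_eq_append (rowList I J) hk
  have hpos : rowPos I J k + 1 + i = (rowCode (rowList I J) k).length + (i + 1) + 2 := by
    rw [rowPos]
    omega
  rw [inputStore_input, inputWord_eq, hR, hpos]
  simp [List.getElem?_append_left hi, List.getElem?_append_right, hi]

/-- Writes the ranks in the list that stands in the input into the rank table. -/
def readListProg : Prog :=
  forLoop index (var length)
    (.write rank (var offset + .read input (var position)) (var index + 1);;
      assign position (var position + 1))

theorem runs_readListProg {L : List ℕ} {o p : ℕ} (hL : L.Nodup) (hN : L.length ≤ N)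
    (hlength : s length 0 = L.length) (hoffset : s offset 0 = o) (hposition : s position 0 = p)
    (hinput : ∀ i (hi : i < L.length), s input (p + i) = L[i]) :
    Runs N readListProg s fun s' => s' position 0 = p + L.length ∧
      s' rank = fun i => if o ≤ i ∧ i - o ∈ L then L.idxOf (i - o) + 1 else s rank i := by
  refine (Runs.forLoop (i := index) (b := var length) (K := L.length)
    (fun k s' => s' position 0 = p + k ∧
      s' rank = fun i => if o ≤ i ∧ i - o ∈ L.take k then L.idxOf (i - o) + 1 else s rank i)
    (by decide) (fun s' hs' => (congrFun (hs' length (by decide)) 0).trans hlength) hN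
    (fun _ _ _ h => h) ⟨hposition, by simp⟩
    fun k hk s' hs'k hs' ⟨hpos, hrank⟩ => .of_wp ?_).mono fun s' hs' => by
      rwa [List.take_length] at hs'
  have hentry : s' input (p + k) = L[k] := hs' input (by decide) ▸ hinput k hk
  have hoff : s' offset 0 = o := hs' offset (by decide) ▸ hoffset
  have hidx : L.idxOf L[k] = k := hL.idxOf_getElem k hk
  have htake : L.take (k + 1) = L.take k ++ [L[k]] := (List.take_append_getElem hk).symm
  simp +decide only [wp, assign, Expr.eval, Expr.eval_var, Store.set_apply, hs'k, hpos, hentry,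
    hoff, hrank, htake, List.mem_append, List.mem_singleton, funext_iff, reduceIte]
  grind

/-- Reads the current row of the rank table from the input. -/
def rowProg : Prog :=
  (.write rowStart (var row) (var offset);;
    assign length (.read input (var position));;
    assign position (var position + 1));;
  readListProg;;
  .write rank (var offset + (jobs + var row)) (jobs + 1);;
  assign offset (var offset + (slots + agents))

theorem runs_rowProg {k o : ℕ} (hk : k < m + m) (hN : n ≤ N)
    (hinput : s input = inputStore (inputWord I J) input) (hrow : s row 0 = k)
    (hposition : s position 0 = rowPos I J k) (hoffset : s offset 0 = o)
    (hrank : ∀ i, o ≤ i → s rank i = 0) :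
    Runs N rowProg s fun s' => s' position 0 = rowPos I J (k + 1) ∧
      s' offset 0 = o + (n + m + m) ∧ s' rowStart = Function.update (s rowStart) k o ∧
      s' rank = fun i => if o ≤ i then rankOf I J k (i - o) else s rank i := by
  have hlen : s input (rowPos I J k) = (rowList I J k).length := hinput ▸ inputStore_rowPos I J hk
  have hm : s input 0 = m := by simp [hinput, inputStore_input, inputWord]
  have hn : s input 1 = n := by simp [hinput, inputStore_input, inputWord]
  refine (Runs.of_wp (Q := fun s' => Frame [rowStart, length, position] s s' ∧
    s' rowStart = Function.update (s rowStart) k o ∧ s' length 0 = (rowList I J k).length ∧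
    s' position 0 = rowPos I J k + 1) ?_).seq fun s₁ ⟨hs₁, hstart, hlength, hpos⟩ => ?_
  · simp +decide only [wp, assign, Expr.eval, Expr.eval_var, Store.set_apply, Frame, funext_iff,
      hrow, hposition, hoffset, Function.update_apply, reduceIte]
    grind
  refine (runs_readListProg (nodup_rowList I J k) ((length_rowList_le I J k).trans hN) hlength
    ((congrFun (hs₁ offset (by decide)) 0).trans hoffset) hpos fun i hi => ?_).frame.seq
      fun s₂ ⟨hs₂, hpos₂, hrank₂⟩ => .of_wp ?_
  · rw [hs₁ input (by decide), hinput]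
    exact inputStore_rowPos_add I J hk hi
  · have heq : ∀ r ∈ ([input, row, offset] : List ℕ), s₂ r = s r := fun r hr =>
      (hs₂.eq_of_mem (by decide) hr).trans (hs₁.eq_of_mem (by decide) hr)
    have hlt : ∀ c ∈ rowList I J k, c < n := fun c hc => mem_rowList_lt hc
    simp +decide only [wp, assign, jobs, slots, agents, Expr.eval, Expr.eval_var, Store.set_apply,
      heq input (by decide), heq row (by decide), heq offset (by decide), hm, hn, hrow, hoffset,
      hpos₂, hrank₂, hs₁ rank (by decide), hs₂ rowStart (by decide), hstart, rowPos_succ,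
      funext_iff, rankOf, reduceIte]
    grind

/-- The memory contains the first `k` rows of the rank table. Each row has `n + m + m` cells, so
that it can hold the outside option in column `n + x`, where `x < m + m` is the number of the
row. -/
structure RowsRead (I J : Market m n) (k : ℕ) (s : Store) : Prop where
  position_eq : s position 0 = rowPos I J k
  offset_eq : s offset 0 = k * (n + m + m)
  rowStart_eq : ∀ x < k, s rowStart x = x * (n + m + m)
  rank_eq : ∀ x < k, ∀ c < n + m, s rank (x * (n + m + m) + c) = rankOf I J x c
  rank_eq_zero : ∀ i, k * (n + m + m) ≤ i → s rank i = 0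

theorem RowsRead.runs_rowProg {k : ℕ} (h : RowsRead I J k s) (hk : k < m + m) (hN : n ≤ N)
    (hinput : s input = inputStore (inputWord I J) input) (hrow : s row 0 = k) :
    Runs N rowProg s (RowsRead I J (k + 1)) := by
  refine (PopularMatching.runs_rowProg hk hN hinput hrow h.position_eq h.offset_eq
    h.rank_eq_zero).mono fun s' ⟨hpos, hoff, hstart, hrank⟩ => ⟨hpos, ?_, fun x hx => ?_,
      fun x hx c hc => ?_, fun i hi => ?_⟩
  · rw [hoff, Nat.succ_mul]
  · rw [hstart, Function.update_apply]
    split_ifs with hxk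
    · rw [hxk]
    · exact h.rowStart_eq x (by omega)
  · rw [hrank]
    rcases Nat.lt_succ_iff_lt_or_eq.1 hx with hx | rfl
    · have hle := Nat.mul_le_mul_right (n + m + m) (Nat.succ_le_of_lt hx)
      rw [Nat.succ_mul] at hle
      exact (if_neg (by omega)).trans (h.rank_eq x hx c hc)
    · simp only [Nat.le_add_right, if_true, Nat.add_sub_cancel_left]
  · rw [Nat.succ_mul] at hi
    rw [hrank]
    exact (if_pos (by omega)).trans ((if_neg (by omega)).trans (if_neg (by omega)))

/-- Reads the rank table from the input. -/
def tableProg : Prog :=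
  assign position 2;; forLoop row (agents + agents) rowProg

theorem runs_tableProg (I J : Market m n) (hn : n ≤ N) (hm : m + m ≤ N) :
    Runs N tableProg (inputStore (inputWord I J)) (Tables m n (rankOf I J)) := by
  refine (Runs.assign _ position 2).seq fun s₁ ⟨hs₁, hpos₁⟩ => ?_
  have hinput : s₁ input = inputStore (inputWord I J) input := hs₁ input (by decide)
  have hagents : s₁ input 0 = m := by simp [hinput, inputStore_input, inputWord]
  have hzero : ∀ r ∈ ([offset, rank] : List ℕ), s₁ r = 0 := fun r hr =>
    (hs₁.eq_of_mem (by decide) hr).trans (inputStore_of_ne _ (by rintro rfl; revert hr; decide))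
  refine (Runs.forLoop (i := row) (K := m + m) (RowsRead I J) (by decide) (fun s hs => ?_) hm
    (fun _ _ _ h => ⟨h.1, h.2, h.3, h.4, h.5⟩)
    ⟨hpos₁, by simp [hzero offset (by decide)], by omega, by omega,
      fun i _ => congrFun (hzero rank (by decide)) i⟩
    fun k hk s hsk hs h =>
      h.runs_rowProg hk hn ((hs input (by decide)).trans hinput) hsk).frame.mono
        fun s ⟨hs, h⟩ => ?_
  · rw [← hs input (by decide)] at hagents
    exact congrArg₂ (· + ·) hagents hagents
  · rw [← hs input (by decide)] at hinput
    refine ⟨by simp [hinput, inputStore_input, inputWord],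
      by simp [hinput, inputStore_input, inputWord], fun x hx c hc => ?_⟩
    rw [h.rowStart_eq x hx]
    exact h.rank_eq x hx c hc

/-- Sets the levels of the jobs to `2` and those of the outside options to `1`. -/
def levelProg : Prog :=
  forLoop index slots
    (.cond (jobs - var index) (.write level (var index) 2) (.write level (var index) 1))

theorem runs_levelProg {rk : ℕ → ℕ → ℕ} (h : Tables m n rk s) (hlevel : s level = 0)
    (hN : n + m ≤ N) :
    Runs N levelProg s fun s' => s' level = (Auction.initial m n).level := by
  refine (Runs.forLoop (i := index) (K := n + m) (fun k s' =>
    s' level = fun t => if t < k then if t < n then 2 else 1 else 0) (by decide)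
    (fun s' hs' => (h.frame hs' (by decide)).eval_slots) hN (fun _ _ _ h => h) ?_
    fun k _ s' hs'k hs' hInv => .of_wp ?_).mono fun s' hs' => ?_
  · simpa [funext_iff] using hlevel
  · have hn : s' input 1 = n := (h.frame hs' (by decide)).jobs_eq
    simp +decide only [wp, jobs, Expr.eval, Expr.eval_sub, Expr.eval_var, Store.set_apply, hs'k,
      hn, hInv, funext_iff]
    grind
  · rw [hs']
    funext t
    simp only [Auction.initial]
    grind

/-- Sets up the rank table and the auction. -/
def setupProg : Prog := tableProg;; levelProg;; assign running 1

theorem runs_setupProg (I J : Market m n) (hn : n + m ≤ N) (hm : m + m ≤ N) :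
    Runs N setupProg (inputStore (inputWord I J)) fun s =>
      Tables m n (rankOf I J) s ∧ auctionOf s = Auction.initial m n := by
  refine (runs_tableProg I J (by omega) hm).frame.seq fun s₁ ⟨hs₁, h₁⟩ => ?_
  have hzero : ∀ r ∈ ([held, level, price, owner, phase] : List ℕ), s₁ r = 0 := fun r hr =>
    (hs₁.eq_of_mem (by decide) hr).trans (inputStore_of_ne _ (by rintro rfl; revert hr; decide))
  refine (runs_levelProg h₁ (hzero level (by decide)) hn).frame.seq
    fun s₂ ⟨hs₂, hlevel⟩ => .write ⟨(h₁.frame hs₂ (by decide)).frame (l := [running])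
      (fun r hr => Store.set_of_ne _ _ _ (List.ne_of_not_mem_cons hr)) (by decide), ?_⟩
  have hheld : s₂ held = 0 := (hs₂ held (by decide)).trans (hzero held (by decide))
  have hprice : s₂ price = 0 := (hs₂ price (by decide)).trans (hzero price (by decide))
  have howner : s₂ owner = 0 := (hs₂ owner (by decide)).trans (hzero owner (by decide))
  have hphase : s₂ phase = 0 := (hs₂ phase (by decide)).trans (hzero phase (by decide))
  simp +decide only [auctionOf, Store.set_apply, Store.set_of_ne, hlevel, hheld, hprice, howner,
    hphase, Auction.initial, Expr.eval_ofNat, Pi.zero_apply]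
  rfl

end Input

section RobustProgram

open Reg

variable {m n N : ℕ} {I J : Market m n}

theorem outputEdges_eq {s : Store} (h : ∀ a < m, s held (a + 1) ≠ 0) :
    outputEdges m n s = edgesOf (jobAssign m n fun a => s held (a + 1) - 1) := by
  ext ⟨a, b⟩
  rw [mem_edgesOf, jobAssign_eq_some]
  simp only [outputEdges, Finset.mem_filter, Finset.mem_univ, true_and]
  exact (Nat.sub_eq_iff_eq_add (Nat.one_le_iff_ne_zero.2 (h a a.2))).symm

/-- The algorithm. -/
def robustProg : Prog := setupProg;; auctionProg;; verdictProg

theorem runs_robustProg (hIJ : I.DifferInOneAgent J) (hn : n + m ≤ N) (hm : m + m ≤ N)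
    (hP : (Auction.initial m n).progress m n ≤ N) :
    Runs N robustProg (inputStore (inputWord I J)) fun s =>
      (verdict s = 1 ∧ I.IsRobustPopular J (outputEdges m n s)) ∨
        (verdict s = 0 ∧ ¬ ∃ M, I.IsRobustPopular J M) := by
  refine (runs_setupProg I J hn hm).seq fun s₁ ⟨h₁, hinitial⟩ => ?_
  refine (runs_auctionProg h₁ (rankTable_rankOf I J) (hinitial ▸ .initial m n _) hn
    (hinitial ▸ hP)).seq fun s₂ ⟨h₂, hA, hhalted⟩ => ?_
  refine (runs_verdictProg h₂ (by omega)).mono ?_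
  rintro s₃ ⟨hheld, ⟨hv, hall⟩ | ⟨hv, hfree⟩⟩
  · refine Or.inl ⟨hv, ?_⟩
    rw [outputEdges_eq (by simpa only [hheld] using hall), hIJ.isRobustPopular_edgesOf]
    simp only [hheld]
    exact ⟨_, (hA.solution hhalted hall).certificate hIJ.1⟩
  · rw [hIJ.exists_isRobustPopular_iff]
    exact Or.inr ⟨hv, hA.not_solution (rankTable_rankOf I J) hhalted hfree⟩

/-- A bound for the number of iterations of every loop of the algorithm, in terms of a bound for the
numbers of agents and jobs. -/
noncomputable def loopBound : Polynomial ℕ :=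
  let X : Polynomial ℕ := Polynomial.X
  let P := (X + X) * (X + 2)
  1 + 2 * X * (2 * (P + 1)) + (P + 1) + P + 2 * X

theorem progress_initial_add_le_loopBound {k : ℕ} (hm : m ≤ k) (hn : n ≤ k) :
    (Auction.initial m n).progress m n + 2 * k ≤ loopBound.eval k := by
  rw [Auction.progress_initial]
  simp only [loopBound, priceBound, Polynomial.eval_add, Polynomial.eval_mul, Polynomial.eval_X,
    Polynomial.eval_one, Polynomial.eval_ofNat]
  gcongr

end RobustProgram

end PopularMatching

theorem mainTheorem3 :
    ∃ (c : PopularMatching.Prog) (p : Polynomial ℕ),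
      ∀ (m n : ℕ) (I J : PopularMatching.Market m n), I.DifferInOneAgent J →
        ∃ (s : PopularMatching.Store) (t : ℕ),
          PopularMatching.Exec c
            (PopularMatching.inputStore (PopularMatching.inputWord I J)) s t ∧
          t ≤ p.eval I.size ∧
          ((PopularMatching.verdict s = 1 ∧
              I.IsRobustPopular J (PopularMatching.outputEdges m n s)) ∨
            (PopularMatching.verdict s = 0 ∧ ¬ ∃ M, I.IsRobustPopular J M)) := by
  refine ⟨PopularMatching.robustProg,
    PopularMatching.robustProg.timeBound.comp PopularMatching.loopBound, fun m n I J hIJ => ?_⟩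
  have hm : m ≤ I.size := (Nat.le_add_right m n).trans (Nat.le_add_right _ _)
  have hn : n ≤ I.size := (Nat.le_add_left n m).trans (Nat.le_add_right _ _)
  have hbound := PopularMatching.progress_initial_add_le_loopBound hm hn
  obtain ⟨s, t, hexec, ht, hs⟩ :=
    PopularMatching.runs_robustProg (N := PopularMatching.loopBound.eval I.size) hIJ
      (by omega) (by omega) (by omega)
  exact ⟨s, t, hexec, ht.trans_eq Polynomial.eval_comp.symm, hs⟩
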